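/- Let $\mathbb F_q$ be the finite field with $q$ elements, and let $R\in(0,1)$ and $\omega\in[0,\frac{q-1}{q}]$ be fixed. For $k,n\in\mathbb N$ and $\mathbf c\in\mathbb F_q^n$ put $$|\psi_{\mathbf c}\rangle=\sum_{\mathbf e\in\mathbb F_q^n}\sqrt{\Big(\tfrac{\omega}{q-1}\Big)^{|\mathbf e|}(1-\omega)^{n-|\mathbf e|}}\;|\mathbf c+\mathbf e\rangle ,$$ where $|\mathbf e|$ is the Hamming weight. In the quantum decoding problem $\mathrm{QDP}(q,n,k,\omega)$ the matrix $\mathbf G\in\mathbb F_q^{k\times n}$ and the message $\mathbf u\in\mathbb F_q^k$ are uniformly random, $\mathbf c=\mathbf u\mathbf G$, and the task is to find $\mathbf c$ from $(\mathbf G,|\psi_{\mathbf c}\rangle)$. An algorithm (without any bound on its resources) is a choice, for each $\mathbf G$, of a POVM with outcomes in $\mathbb F_q^n$; it succeeds if the outcome is $\mathbf c$, and its success probability is over $\mathbf G$, $\mathbf u$ and the measurement. For the code $\mathcal C=\{\mathbf u\mathbf G:\mathbf u\in\mathbb F_q^k\}$ the pretty good measurement (PGM) is $M_{\mathbf c}=\rho^{-1/2}|\psi_{\mathbf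 c}\rangle\langle\psi_{\mathbf c}|\rho^{-1/2}$, $\mathbf c\in\mathcal C$, where $\rho=\sum_{\mathbf c\in\mathcal C}|\psi_{\mathbf c}\rangle\langle\psi_{\mathbf c}|$ and $\rho^{-1/2}$ is the inverse square root on the support of $\rho$, extended by $0$. Let $\mathrm P_{\mathrm{PGM}}(n)$ be its success probability on $\mathrm{QDP}(q,n,\lfloor Rn\rfloor,\omega)$, averaged over $\mathbf G$ and $\mathbf u$. Let $h_q(x)=-(1-x)\log_q(1-x)-x\log_q\frac{x}{q-1}$ (with $0\log_q 0=0$), a bijection from $[0,\frac{q-1}{q}]$ to $[0,1]$ with inverse $h_q^{-1}$; let $\delta_{\min}(R)=h_q^{-1}(1-R)$ be the relative Gilbert–Varshamov distance, and $x^\perp=\frac1q\big(\sqrt{(1-x)(q-1)}-\sqrt x\big)^2$ for $x\in[0,1]$. Then, as $n\to\infty$: 1. If $\omega<(\delta_{\min}(1-R))^\perp$, then $\mathrm P_{\mathrm{PGM}}(n)=1-o(1)$ (in particular it is $\Omega(1)$). Hence the problem is tractable: there are algorithms for $\mathrm{QDP}(q,n,\lfloor Rn\rfloor,\omega)$ with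 success probability $1-o(1)$. 2. If $\omega>(\delta_{\min}(1-R))^\perp$, then $\mathrm P_{\mathrm{PGM}}(n)=o(1)$. Hence the problem is intractable: every sequence of algorithms for $\mathrm{QDP}(q,n,\lfloor Rn\rfloor,\omega)$ has success probability $o(1)$. -/

import Mathlib

open Filter Topology Matrix
open scoped ComplexOrder

noncomputable section

namespace QDP

/-! ### The Gilbert–Varshamov distance and the map `x ↦ x^⊥` -/

/-- The `q`-ary entropy
`h_q(x) = -(1-x) log_q (1-x) - x log_q (x/(q-1))`, i.e. Mathlib's `Real.qaryEntropy`
(natural logarithms) rescaled to base `q`. -/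
def entropy (q : ℕ) (x : ℝ) : ℝ := Real.qaryEntropy q x / Real.log q

/-- The inverse of the bijection `h_q : [0, (q-1)/q] → [0, 1]`. -/
def entropyInv (q : ℕ) (y : ℝ) : ℝ :=
  Function.invFunOn (entropy q) (Set.Icc 0 (((q : ℝ) - 1) / q)) y

/-- The relative Gilbert–Varshamov distance `δ_min(R) = h_q⁻¹(1 - R)`. -/
def deltaMin (q : ℕ) (R : ℝ) : ℝ := entropyInv q (1 - R)

/-- `x^⊥ = (√((1-x)(q-1)) - √x)² / q`. -/
def perp (q : ℕ) (x : ℝ) : ℝ := (√((1 - x) * ((q : ℝ) - 1)) - √x) ^ 2 / q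

/-! ### Quantum measurements on a finite-dimensional space with basis `X` -/

section Measurement

variable {X ι : Type*} [Fintype X] [DecidableEq X] [Fintype ι]

/-- The operator `|ψ⟩⟨ψ|`. -/
def ketbra (ψ : X → ℂ) : Matrix X X ℂ := Matrix.vecMulVec ψ (star ψ)

/-- The probability `tr(|ψ⟩⟨ψ| M)` of the outcome with operator `M` when measuring `|ψ⟩`. -/
def outcomeProb (ψ : X → ℂ) (M : Matrix X X ℂ) : ℝ := (Matrix.trace (ketbra ψ * M)).re

/-- `N` is a POVM: positive semidefinite operators that sum to the identity. -/
def IsPOVM (N : ι → Matrix X X ℂ) : Prop := (∀ i, (N i).PosSemidef) ∧ ∑ i, N i = 1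

/-- `ρ = ∑ᵢ |ψᵢ⟩⟨ψᵢ|`. -/
def ensembleSum (ψ : ι → X → ℂ) : Matrix X X ℂ := ∑ i, ketbra (ψ i)

/-- `ρ^{-1/2}` for a positive semidefinite `ρ`, taken on the support of `ρ` (and zero on its
kernel), by functional calculus: here `(√0)⁻¹ = 0`. -/
def invSqrt (ρ : Matrix X X ℂ) : Matrix X X ℂ := cfc (fun x : ℝ => (√x)⁻¹) ρ

/-- The pretty good measurement `Mᵢ = ρ^{-1/2} |ψᵢ⟩⟨ψᵢ| ρ^{-1/2}` of an ensemble `ψ`. -/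
def pgm (ψ : ι → X → ℂ) (i : ι) : Matrix X X ℂ :=
  invSqrt (ensembleSum ψ) * ketbra (ψ i) * invSqrt (ensembleSum ψ)

end Measurement

/-! ### The quantum decoding problem -/

section Decoding

variable {F : Type*} [Field F] [Fintype F] [DecidableEq F] {k n : ℕ}

/-- The codewords `u G`, `u ∈ F^k`, of the code generated by `G`. -/
def codewords (G : Matrix (Fin k) (Fin n) F) : Finset (Fin n → F) :=
  Finset.univ.image fun u : Fin k → F => u ᵥ* G

/-- The codeword `u G` that encodes the message `u`. -/
def encode (G : Matrix (Fin k) (Fin n) F) (u : Fin k → F) : codewords G :=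
  ⟨u ᵥ* G, Finset.mem_image_of_mem _ (Finset.mem_univ u)⟩

/-- The amplitude `√((ω/(q-1))^|e| (1-ω)^(n-|e|))` of the error `e`, with `|e|` the Hamming
weight and `q = |F|`. -/
def amplitude (ω : ℝ) (e : Fin n → F) : ℝ :=
  √((ω / ((Fintype.card F : ℝ) - 1)) ^ hammingNorm e * (1 - ω) ^ (n - hammingNorm e))

/-- The state `|ψ_c⟩ = ∑ₑ f(e) |c + e⟩`, given by its coordinates: that of `|y⟩` is `f(y - c)`. -/
def state (ω : ℝ) (c : Fin n → F) : (Fin n → F) → ℂ := fun y => (amplitude ω (y - c) : ℂ)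

/-- The probability, over uniform `G ∈ F^{k × n}`, uniform `u ∈ F^k` and the measurement, that the
transmitted codeword `c = u G` is the outcome when `|ψ_c⟩` is measured; `M G c` is the operator
of the outcome `c` in the measurement used for `G`. -/
def success (ω : ℝ)
    (M : (G : Matrix (Fin k) (Fin n) F) → codewords G →
      Matrix (Fin n → F) (Fin n → F) ℂ) : ℝ :=
  (∑ G : Matrix (Fin k) (Fin n) F,
      (∑ u : Fin k → F, outcomeProb (state ω (encode G u).1) (M G (encode G u))) /
        Fintype.card (Fin k → F)) /
    Fintype.card (Matrix (Fin k) (Fin n) F)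

variable (F k n) in
/-- The success probability, averaged over the code, of the pretty good measurement of the
ensemble `{|ψ_c⟩}` indexed by the codewords `c`. -/
def pgmSuccess (ω : ℝ) : ℝ :=
  success (F := F) (k := k) (n := n) ω
    fun G => pgm fun c : codewords G => state ω c.1

variable (F k n) in
/-- An algorithm for the decoding problem, with unbounded resources: given `G`, it performs an
arbitrary measurement whose outcome is the returned vector of `F^n`. -/
structure Algorithm where
  /-- the operator of the outcome `x` when the generating matrix is `G` -/
  op : Matrix (Fin k) (Fin n) F → (Fin n → F) → Matrix (Fin n → F) (Fin n → F) ℂ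
  isPOVM : ∀ G, IsPOVM (op G)

/-- The probability that the algorithm `A` returns the transmitted codeword. -/
def Algorithm.successProb (A : Algorithm F k n) (ω : ℝ) : ℝ :=
  success (F := F) (k := k) (n := n) ω fun G c => A.op G c.1

end Decoding

end QDP

end

noncomputable section

namespace QDP

set_option linter.unusedSectionVars false

/-! ### The involution `perp` and the Gilbert–Varshamov threshold -/

section Threshold

variable {q : ℕ} {x : ℝ}

/-! Write `τ = perp q ω`, `K = q^k`, and let `H` be the entropy of `letterProb τ` in nats. In the
character basis the error amplitude for `ω` becomes the error amplitude for `τ`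
(`sqrt_letterProb_eq`, `state_eq_sum`), and shifting by a codeword only multiplies by phases.
Grouping frequencies `x` by their syndrome `G x = s` gives `|ψ_{uG}⟩ = ∑ₛ φ(-u·s) v_s`, with the
`v_s` orthogonal and `‖v_s‖² = p_s`, the probability that a random `τ`-error has syndrome `s`.

If distinct messages have distinct codewords, orthogonality of characters makes each `v_s` satisfy
`ρ v_s = K p_s v_s`. The PGM then succeeds with probability `t²`, where `t = ∑ₛ √(p_s / K)` is the
fidelity between the syndrome distribution and the uniform one. So the question is whether a random
`G` hashes the error to a nearly uniform syndrome.

If `H > R log q` it does: a fixed nonzero vector is in the kernel of `G` with probability `1/K`, so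
the average collision probability of syndromes of typical errors is close to `1/K`, and this forces
`t` close to 1 (`pgm_codeSuccess_ge`, `average_collision_le`).

If `H < R log q`, no measurement works: up to small norm the states lie in the span of about
`e^{nH}` characters, too small a dimension to tell `K` messages apart (`codeSuccess_le`).

Typicality is Chebyshev's inequality (`exists_tail_bound`), and codes with colliding messages are
rare (`card_degenerate_le`). Finally, `perp` is a decreasing involution and the entropy is
increasing on `[0, (q-1)/q]`, so comparing `ω` with `(δ_min(1-R))^⊥` is comparing `R log q` with
`H`, in the opposite order. -/

theorem le_one_of_mem (hq : 2 ≤ q) (hx : x ≤ ((q : ℝ) - 1) / q) : x ≤ 1 := by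
  have h2 : (2 : ℝ) ≤ q := by exact_mod_cast hq
  refine hx.trans ?_
  rw [div_le_one (by linarith)]
  linarith

/-- This fixes the sign of the difference squared in `perp`, so that `√(perp q x)` is that
difference and not just its absolute value. -/
theorem sqrt_le_of_mem (hq : 2 ≤ q) (hx : x ≤ ((q : ℝ) - 1) / q) :
    √x ≤ √((1 - x) * ((q : ℝ) - 1)) := by
  have h2 : (2 : ℝ) ≤ q := by exact_mod_cast hq
  rw [le_div_iff₀ (by linarith)] at hx
  exact Real.sqrt_le_sqrt (by nlinarith)

theorem sqrt_perp (hq : 2 ≤ q) (hx : x ≤ ((q : ℝ) - 1) / q) :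
    √(perp q x) = (√(1 - x) * √((q : ℝ) - 1) - √x) / √q := by
  have h := sqrt_le_of_mem hq hx
  rw [perp, Real.sqrt_div (sq_nonneg _), Real.sqrt_sq (by linarith), Real.sqrt_mul]
  linarith [le_one_of_mem hq hx]

theorem one_sub_perp (hq : 2 ≤ q) (hx0 : 0 ≤ x) (hx : x ≤ ((q : ℝ) - 1) / q) :
    1 - perp q x = (√(1 - x) + √((q : ℝ) - 1) * √x) ^ 2 / q := by
  have h2 : (2 : ℝ) ≤ q := by exact_mod_cast hq
  have hx1 := le_one_of_mem hq hx
  have ha := Real.sq_sqrt hx0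
  have hb := Real.sq_sqrt (sub_nonneg.2 hx1)
  have hc := Real.sq_sqrt (show (0 : ℝ) ≤ q - 1 by linarith)
  rw [perp, Real.sqrt_mul (by linarith), eq_div_iff (by linarith), sub_mul, div_mul_cancel₀ _
    (by linarith), one_mul]
  have e1 : (√(1 - x) * √((q : ℝ) - 1) - √x) ^ 2
      = √(1 - x) ^ 2 * √((q : ℝ) - 1) ^ 2 + √x ^ 2 - 2 * (√(1 - x) * √((q : ℝ) - 1) * √x) := by ring
  have e2 : (√(1 - x) + √((q : ℝ) - 1) * √x) ^ 2
      = √(1 - x) ^ 2 + √((q : ℝ) - 1) ^ 2 * √x ^ 2 + 2 * (√(1 - x) * √((q : ℝ) - 1) * √x) := by ring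
  rw [e1, e2, ha, hb, hc]
  ring

theorem sqrt_one_sub_perp (hq : 2 ≤ q) (hx0 : 0 ≤ x) (hx : x ≤ ((q : ℝ) - 1) / q) :
    √(1 - perp q x) = (√(1 - x) + √((q : ℝ) - 1) * √x) / √q := by
  rw [one_sub_perp hq hx0 hx, Real.sqrt_div (sq_nonneg _), Real.sqrt_sq (by positivity)]

theorem perp_nonneg (q : ℕ) (x : ℝ) : 0 ≤ perp q x := by unfold perp; positivity

theorem perp_le (hq : 2 ≤ q) (hx0 : 0 ≤ x) (hx : x ≤ ((q : ℝ) - 1) / q) :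
    perp q x ≤ ((q : ℝ) - 1) / q := by
  have h2 : (2 : ℝ) ≤ q := by exact_mod_cast hq
  have h := sqrt_le_of_mem hq hx
  have hx1 := le_one_of_mem hq hx
  rw [perp]
  refine div_le_div_of_nonneg_right ?_ (by linarith)
  have : (√((1 - x) * ((q : ℝ) - 1)) - √x) ^ 2 ≤ √((1 - x) * ((q : ℝ) - 1)) ^ 2 :=
    pow_le_pow_left₀ (by linarith) (by linarith [Real.sqrt_nonneg x]) 2
  rw [Real.sq_sqrt (mul_nonneg (by linarith) (by linarith))] at this
  nlinarith

/-- On the unit vector `(√(1-x), √x)` the map acts as the symmetric matrix `(1/√q) [[1, s], [s,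
-1]]` with `s = √(q-1)`. Since `1 + s² = q`, this is a reflection, hence an involution. -/
theorem perp_perp (hq : 2 ≤ q) (hx0 : 0 ≤ x) (hx : x ≤ ((q : ℝ) - 1) / q) :
    perp q (perp q x) = x := by
  have h2 : (2 : ℝ) ≤ q := by exact_mod_cast hq
  have hp := perp_le hq hx0 hx
  have hc := Real.sq_sqrt (show (0 : ℝ) ≤ q - 1 by linarith)
  have hs := Real.sq_sqrt (show (0 : ℝ) ≤ q by linarith)
  have hs0 : 0 < √(q : ℝ) := Real.sqrt_pos.2 (by linarith)
  have : √(perp q (perp q x)) = √x := by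
    rw [sqrt_perp hq hp, sqrt_perp hq hx, sqrt_one_sub_perp hq hx0 hx]
    field_simp
    rw [hs]
    linear_combination √x * hc
  exact (Real.sqrt_inj (perp_nonneg _ _) hx0).1 this

theorem perp_strictAntiOn (hq : 2 ≤ q) :
    StrictAntiOn (perp q) (Set.Icc 0 (((q : ℝ) - 1) / q)) := by
  intro x hx y hy hxy
  have h2 : (2 : ℝ) ≤ q := by exact_mod_cast hq
  have h1 : √x < √y := Real.sqrt_lt_sqrt hx.1 hxy
  have h3 : √((1 - y) * ((q : ℝ) - 1)) ≤ √((1 - x) * ((q : ℝ) - 1)) :=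
    Real.sqrt_le_sqrt (mul_le_mul_of_nonneg_right (by linarith) (by linarith))
  have h4 := sqrt_le_of_mem hq hy.2
  unfold perp
  refine div_lt_div_of_pos_right ?_ (by linarith)
  exact pow_lt_pow_left₀ (by linarith) (by linarith) two_ne_zero

theorem interval_eq (hq : 2 ≤ q) : ((q : ℝ) - 1) / q = 1 - 1 / q := by
  have h2 : (2 : ℝ) ≤ q := by exact_mod_cast hq
  rw [sub_div, div_self (by linarith)]

theorem qaryEntropy_max (hq : 2 ≤ q) : Real.qaryEntropy q (((q : ℝ) - 1) / q) = Real.log q := by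
  have h2 : (2 : ℝ) ≤ q := by exact_mod_cast hq
  have h1 : 1 - ((q : ℝ) - 1) / q = (q : ℝ)⁻¹ := by field_simp; ring
  have e : ((q : ℝ) - 1) / q = 1 - (q : ℝ)⁻¹ := by field_simp
  rw [Real.qaryEntropy, Real.binEntropy_eq_negMulLog_add_negMulLog_one_sub, h1, Real.negMulLog,
    Real.negMulLog, Real.log_div (by linarith) (by linarith), Real.log_inv, e]
  push_cast
  ring

theorem deltaMin_mem (hq : 2 ≤ q) {R : ℝ} (h0 : 0 ≤ R) (h1 : R ≤ 1) :
    deltaMin q (1 - R) ∈ Set.Icc 0 (((q : ℝ) - 1) / q) ∧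
      Real.qaryEntropy q (deltaMin q (1 - R)) = R * Real.log q := by
  have h2 : (2 : ℝ) ≤ q := by exact_mod_cast hq
  have hl : 0 < Real.log q := Real.log_pos (by linarith)
  have hle : (0 : ℝ) ≤ ((q : ℝ) - 1) / q := div_nonneg (by linarith) (by linarith)
  have hex : ∃ a ∈ Set.Icc 0 (((q : ℝ) - 1) / q), entropy q a = R := by
    have hc : ContinuousOn (entropy q) (Set.Icc 0 (((q : ℝ) - 1) / q)) :=
      (Real.qaryEntropy_continuous.div_const _).continuousOn
    refine intermediate_value_Icc hle hc ⟨?_, ?_⟩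
    · simp [entropy, h0]
    · rw [entropy, qaryEntropy_max hq, div_self hl.ne']
      exact h1
  -- The Gilbert–Varshamov distance is taken at the dual rate `1 - R`, so the entropy is inverted at
  -- `R` itself.
  have he : 1 - (1 - R) = R := by ring
  rw [deltaMin, entropyInv, he]
  refine ⟨Function.invFunOn_mem hex, ?_⟩
  have := Function.invFunOn_eq hex
  rwa [entropy, div_eq_iff hl.ne'] at this

theorem lt_qaryEntropy_perp (hq : 2 ≤ q) {R ω : ℝ} (h0 : 0 ≤ R) (h1 : R ≤ 1)
    (hω0 : 0 ≤ ω) (hω1 : ω ≤ ((q : ℝ) - 1) / q) (h : ω < perp q (deltaMin q (1 - R))) :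
    R * Real.log q < Real.qaryEntropy q (perp q ω) := by
  obtain ⟨hd, he⟩ := deltaMin_mem hq h0 h1
  have := perp_strictAntiOn hq ⟨hω0, hω1⟩ ⟨perp_nonneg _ _, perp_le hq hd.1 hd.2⟩ h
  rw [perp_perp hq hd.1 hd.2] at this
  rw [← he]
  refine Real.qaryEntropy_strictMonoOn hq ?_ ?_ this <;> rw [← interval_eq hq]
  exacts [hd, ⟨perp_nonneg _ _, perp_le hq hω0 hω1⟩]

theorem qaryEntropy_perp_lt (hq : 2 ≤ q) {R ω : ℝ} (h0 : 0 ≤ R) (h1 : R ≤ 1)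
    (hω0 : 0 ≤ ω) (hω1 : ω ≤ ((q : ℝ) - 1) / q) (h : perp q (deltaMin q (1 - R)) < ω) :
    Real.qaryEntropy q (perp q ω) < R * Real.log q := by
  obtain ⟨hd, he⟩ := deltaMin_mem hq h0 h1
  have := perp_strictAntiOn hq ⟨perp_nonneg _ _, perp_le hq hd.1 hd.2⟩ ⟨hω0, hω1⟩ h
  rw [perp_perp hq hd.1 hd.2] at this
  rw [← he]
  refine Real.qaryEntropy_strictMonoOn hq ?_ ?_ this <;> rw [← interval_eq hq]
  exacts [⟨perp_nonneg _ _, perp_le hq hω0 hω1⟩, hd]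

end Threshold

/-! ### Concentration for product distributions -/

section Concentration

variable {F : Type*} [Fintype F]

/-- The probability of `x` under the product distribution with letter probabilities `p`. -/
def prodProb (p : F → ℝ) {n : ℕ} (x : Fin n → F) : ℝ := ∏ i, p (x i)

theorem prodProb_nonneg {F : Type*} {p : F → ℝ} (hp : ∀ a, 0 ≤ p a) {n : ℕ} (x : Fin n → F) :
    0 ≤ prodProb p x := Finset.prod_nonneg fun i _ => hp (x i)

theorem sum_prodProb {p : F → ℝ} (hp1 : ∑ a, p a = 1) (n : ℕ) :
    ∑ x : Fin n → F, prodProb p x = 1 := by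
  unfold prodProb
  rw [← Fintype.sum_pow, hp1, one_pow]

theorem sum_fin_succ {M : Type*} [AddCommMonoid M] {n : ℕ} (g : (Fin (n + 1) → F) → M) :
    ∑ x, g x = ∑ a : F, ∑ x : Fin n → F, g (Fin.cons a x) := by
  rw [← Fintype.sum_prod_type']
  exact (Fintype.sum_equiv (Fin.consEquiv fun _ : Fin (n + 1) => F) _ _ fun _ => rfl).symm

theorem sum_prodProb_mul_sum {p Y : F → ℝ} (hp1 : ∑ a, p a = 1) (hY : ∑ a, p a * Y a = 0)
    (n : ℕ) : ∑ x : Fin n → F, prodProb p x * ∑ i, Y (x i) = 0 := by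
  induction n with
  | zero => simp
  | succ n ih =>
    rw [sum_fin_succ]
    have : ∀ a, ∑ x : Fin n → F, prodProb p (Fin.cons a x : Fin (n + 1) → F) *
        ∑ i, Y ((Fin.cons a x : Fin (n + 1) → F) i) = p a * Y a := by
      intro a
      have : ∀ x : Fin n → F, prodProb p (Fin.cons a x : Fin (n + 1) → F) *
          ∑ i, Y ((Fin.cons a x : Fin (n + 1) → F) i) =
          p a * Y a * prodProb p x + p a * (prodProb p x * ∑ i, Y (x i)) := by
        intro x
        simp only [prodProb, Fin.prod_univ_succ, Fin.sum_univ_succ, Fin.cons_zero, Fin.cons_succ]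
        ring
      simp_rw [this]
      rw [Finset.sum_add_distrib, ← Finset.mul_sum, ← Finset.mul_sum, ih, sum_prodProb hp1]
      ring
    simp_rw [this]
    exact hY

/-- Variance is additive over independent letters: on splitting off one letter, the cross term
vanishes because `Y` has mean zero. -/
theorem sum_prodProb_mul_sum_sq {p Y : F → ℝ} (hp1 : ∑ a, p a = 1) (hY : ∑ a, p a * Y a = 0)
    (n : ℕ) : ∑ x : Fin n → F, prodProb p x * (∑ i, Y (x i)) ^ 2 = n * ∑ a, p a * Y a ^ 2 := by
  induction n with
  | zero => simp
  | succ n ih =>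
    rw [sum_fin_succ]
    have : ∀ a, ∑ x : Fin n → F, prodProb p (Fin.cons a x : Fin (n + 1) → F) *
        (∑ i, Y ((Fin.cons a x : Fin (n + 1) → F) i)) ^ 2 =
          p a * Y a ^ 2 + p a * (n * ∑ a, p a * Y a ^ 2) := by
      intro a
      have : ∀ x : Fin n → F, prodProb p (Fin.cons a x : Fin (n + 1) → F) *
          (∑ i, Y ((Fin.cons a x : Fin (n + 1) → F) i)) ^ 2 =
          p a * Y a ^ 2 * prodProb p x + 2 * p a * Y a * (prodProb p x * ∑ i, Y (x i)) +
            p a * (prodProb p x * (∑ i, Y (x i)) ^ 2) := by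
        intro x
        simp only [prodProb, Fin.prod_univ_succ, Fin.sum_univ_succ, Fin.cons_zero, Fin.cons_succ]
        ring
      simp_rw [this]
      rw [Finset.sum_add_distrib, Finset.sum_add_distrib, ← Finset.mul_sum, ← Finset.mul_sum,
        ← Finset.mul_sum, ih, sum_prodProb hp1, sum_prodProb_mul_sum hp1 hY]
      ring
    simp_rw [this]
    rw [Finset.sum_add_distrib, ← Finset.sum_mul, hp1]
    push_cast
    ring

/-- The Shannon entropy of `p`, in nats. -/
def shannon (p : F → ℝ) : ℝ := ∑ a, p a * -Real.log (p a)

/-- Chebyshev's inequality for the log-likelihood, a sum of independent centred letters; `V` is the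
variance of one letter, the same for all `n` and `δ`. Letters of probability zero are allowed:
`Real.log 0 = 0` is harmless, being weighted by zero. -/
theorem exists_tail_bound {p : F → ℝ} (hp : ∀ a, 0 ≤ p a) (hp1 : ∑ a, p a = 1) :
    ∃ V : ℝ, ∀ (n : ℕ) (δ : ℝ) (S : Finset (Fin n → F)), 0 < n → 0 < δ →
      (∀ x ∈ S, prodProb p x ≠ 0 → δ * n ≤ |Real.log (prodProb p x) + n * shannon p|) →
      ∑ x ∈ S, prodProb p x ≤ V / δ ^ 2 / n := by
  set Y : F → ℝ := fun a => Real.log (p a) + shannon p with hYdef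
  have hY : ∑ a, p a * Y a = 0 := by
    simp only [hYdef, mul_add, Finset.sum_add_distrib, ← Finset.sum_mul, hp1]
    simp [shannon]
  refine ⟨∑ a, p a * Y a ^ 2, fun n δ S hn hδ hS => ?_⟩
  have hn' : (0 : ℝ) < n := by exact_mod_cast hn
  have key : ∀ x ∈ S, (δ * n) ^ 2 * prodProb p x ≤ prodProb p x * (∑ i, Y (x i)) ^ 2 := by
    intro x hx
    by_cases h0 : prodProb p x = 0
    · simp [h0]
    have hlog : Real.log (prodProb p x) + n * shannon p = ∑ i, Y (x i) := by
      rw [prodProb, Real.log_prod (fun i _ => (Finset.prod_ne_zero_iff.1 h0) i (Finset.mem_univ i))]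
      simp [hYdef, Finset.sum_add_distrib]
    have h1 := hS x hx h0
    rw [hlog] at h1
    rw [mul_comm, ← sq_abs (∑ i, Y (x i))]
    exact mul_le_mul_of_nonneg_left (pow_le_pow_left₀ (by positivity) h1 2) (prodProb_nonneg hp x)
  have h2 : (δ * n) ^ 2 * ∑ x ∈ S, prodProb p x ≤ n * ∑ a, p a * Y a ^ 2 := by
    rw [Finset.mul_sum, ← sum_prodProb_mul_sum_sq hp1 hY n]
    refine (Finset.sum_le_sum key).trans ?_
    exact Finset.sum_le_sum_of_subset_of_nonneg (Finset.subset_univ _) fun x _ _ =>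
      mul_nonneg (prodProb_nonneg hp x) (sq_nonneg _)
  rw [div_div, le_div_iff₀ (by positivity)]
  have h3 : n * ((∑ x ∈ S, prodProb p x) * (δ ^ 2 * n)) ≤ n * ∑ a, p a * Y a ^ 2 := by
    refine le_trans (le_of_eq ?_) h2
    ring
  exact le_of_mul_le_mul_left h3 hn'

end Concentration

/-! ### The error distribution and its Fourier transform -/

section Letter

variable {F : Type*} [Field F] [Fintype F] [DecidableEq F]

/-- The distribution of one letter of the error: weight `1 - τ` on `0`, the rest uniform. -/
def letterProb (τ : ℝ) (a : F) : ℝ := if a = 0 then 1 - τ else τ / ((Fintype.card F : ℝ) - 1)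

theorem two_le_card {F : Type*} [Field F] [Fintype F] : 2 ≤ Fintype.card F := Fintype.one_lt_card

theorem two_le_card_cast (F : Type*) [Field F] [Fintype F] : (2 : ℝ) ≤ Fintype.card F := by exact_mod_cast two_le_card (F := F)

theorem letterProb_nonneg {τ : ℝ} (h0 : 0 ≤ τ) (h1 : τ ≤ 1) (a : F) : 0 ≤ letterProb τ a := by
  have := two_le_card_cast F
  unfold letterProb
  split_ifs
  · linarith
  · exact div_nonneg h0 (by linarith)

theorem sum_letter {M : Type*} [AddCommGroup M] [Module ℝ M] (g : ℝ → M) (τ : ℝ) :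
    ∑ a : F, g (letterProb τ a) =
      g (1 - τ) + ((Fintype.card F : ℝ) - 1) • g (τ / ((Fintype.card F : ℝ) - 1)) := by
  rw [Fintype.sum_eq_add_sum_compl (0 : F)]
  have h : ∀ a ∈ ({0}ᶜ : Finset F), g (letterProb τ a) =
      g (τ / ((Fintype.card F : ℝ) - 1)) := by
    intro a ha
    rw [letterProb, if_neg (by simpa using ha)]
  rw [Finset.sum_congr rfl h, Finset.sum_const, Finset.card_compl, Finset.card_singleton,
    ← Nat.cast_smul_eq_nsmul ℝ, Nat.cast_sub (by linarith [two_le_card (F := F)])]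
  simp [letterProb]

theorem sum_letterProb (τ : ℝ) : ∑ a : F, letterProb τ a = 1 := by
  have := two_le_card_cast F
  have h : (Fintype.card F : ℝ) - 1 ≠ 0 := by linarith
  rw [sum_letter (fun t => t), smul_eq_mul, mul_div_cancel₀ _ h]
  ring

theorem shannon_letterProb (τ : ℝ) :
    shannon (letterProb τ : F → ℝ) = Real.qaryEntropy (Fintype.card F) τ := by
  have := two_le_card_cast F
  have h : (Fintype.card F : ℝ) - 1 ≠ 0 := by linarith
  rw [shannon, sum_letter (fun t => t * -Real.log t), smul_eq_mul, Real.qaryEntropy,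
    Real.binEntropy_eq_negMulLog_add_negMulLog_one_sub, Real.negMulLog, Real.negMulLog]
  push_cast
  rw [← mul_assoc, mul_div_cancel₀ _ h]
  rcases eq_or_ne τ 0 with rfl | h0
  · simp
  · rw [Real.log_div h0 h]
    ring

variable {n : ℕ}

theorem prodProb_letterProb (τ : ℝ) (e : Fin n → F) : prodProb (letterProb τ) e =
    (τ / ((Fintype.card F : ℝ) - 1)) ^ hammingNorm e * (1 - τ) ^ (n - hammingNorm e) := by
  unfold prodProb letterProb
  rw [Finset.prod_ite, Finset.prod_const, Finset.prod_const, mul_comm]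
  congr 2
  have h := Finset.card_filter_add_card_filter_not (s := Finset.univ) (fun i => e i = 0)
  rw [Finset.card_univ, Fintype.card_fin] at h
  have h' : hammingNorm e = (Finset.univ.filter fun i => ¬ e i = 0).card := rfl
  omega

theorem amplitude_eq (τ : ℝ) (e : Fin n → F) :
    amplitude τ e = √(prodProb (letterProb τ) e) := by
  rw [prodProb_letterProb, amplitude]

theorem amplitude_sq {τ : ℝ} (h0 : 0 ≤ τ) (h1 : τ ≤ 1) (e : Fin n → F) :
    amplitude τ e ^ 2 = prodProb (letterProb τ) e := by
  rw [amplitude_eq, Real.sq_sqrt (prodProb_nonneg (letterProb_nonneg h0 h1) e)]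

theorem amplitude_eq_prod {τ : ℝ} (h0 : 0 ≤ τ) (h1 : τ ≤ 1) (e : Fin n → F) :
    amplitude τ e = ∏ i, √(letterProb τ (e i)) := by
  rw [amplitude_eq, prodProb, Real.sqrt_prod _ fun i _ => letterProb_nonneg h0 h1 (e i)]

variable {φ : AddChar F ℂ}

theorem sum_addChar_mul (hφ : φ.IsPrimitive) (b : F) :
    ∑ x, φ (x * b) = if b = 0 then (Fintype.card F : ℂ) else 0 := by
  rw [AddChar.sum_mulShift b hφ]
  split_ifs <;> simp

/-- The one-letter amplitude takes one value at 0 and another elsewhere, so it is a constant plus a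
point mass at 0. The Fourier transform exchanges these two kinds of function, and `perp` records the
resulting parameter. -/
theorem sqrt_letterProb_eq (hφ : φ.IsPrimitive) {ω : ℝ} (h0 : 0 ≤ ω)
    (h1 : ω ≤ ((Fintype.card F : ℝ) - 1) / Fintype.card F) (y : F) :
    (√(letterProb ω y) : ℂ) =
      ∑ x : F, √(letterProb (perp (Fintype.card F) ω) x) *
        (φ (x * y) / √(Fintype.card F : ℝ)) := by
  have hq := two_le_card_cast F
  set q : ℕ := Fintype.card F with hqdef
  set τ := perp q ω with hτ
  have hs := Real.sq_sqrt (show (0 : ℝ) ≤ q - 1 by linarith)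
  have hs0 : 0 < √((q : ℝ) - 1) := Real.sqrt_pos.2 (by linarith)
  have hr := Real.sq_sqrt (show (0 : ℝ) ≤ q by linarith)
  have hr0 : 0 < √(q : ℝ) := Real.sqrt_pos.2 (by linarith)
  have hz : (√(letterProb τ (0 : F))) =
      (√(1 - ω) + √((q : ℝ) - 1) * √ω) / √q := by
    simp only [letterProb, if_true]
    exact sqrt_one_sub_perp two_le_card h0 h1
  have hnz : ∀ x : F, x ≠ 0 → √(letterProb τ x) =
      (√(1 - ω) * √((q : ℝ) - 1) - √ω) / √q / √((q : ℝ) - 1) := by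
    intro x hx
    rw [letterProb, if_neg hx, ← hqdef, Real.sqrt_div (perp_nonneg _ _),
      sqrt_perp two_le_card h1]
  set A := (√(1 - ω) + √((q : ℝ) - 1) * √ω) / √q with hA
  set B := (√(1 - ω) * √((q : ℝ) - 1) - √ω) / √q / √((q : ℝ) - 1) with hB
  have hsplit : ∀ x : F, (√(letterProb τ x) : ℂ) * (φ (x * y) / √(q : ℝ)) =
      (B : ℂ) / √(q : ℝ) * φ (x * y) + if x = 0 then ((A : ℂ) - B) / √(q : ℝ) else 0 := by
    intro x
    split_ifs with hx
    · rw [hx, hz]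
      simp
      ring
    · rw [hnz x hx]
      ring
  simp_rw [hsplit]
  rw [Finset.sum_add_distrib, ← Finset.mul_sum, sum_addChar_mul hφ, Finset.sum_ite_eq',
    if_pos (Finset.mem_univ _)]
  rw [letterProb]
  split_ifs with hy
  · rw [← hqdef]
    have : √(1 - ω) = B / √q * q + (A - B) / √q := by
      have : (q : ℝ) = √((q : ℝ) - 1) ^ 2 + 1 := by linarith
      rw [hA, hB]
      field_simp
      rw [hr]
      linear_combination √ω * this
    exact_mod_cast this
  · have : √(ω / ((q : ℝ) - 1)) = (A - B) / √q := by
      rw [Real.sqrt_div h0, hA, hB]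
      field_simp
      rw [hr]
      linear_combination - √ω * hs
    rw [mul_zero, zero_add, ← hqdef]
    exact_mod_cast this

/-- The normalized character of `F^n` at frequency `x`. -/
def charVec (φ : AddChar F ℂ) (x : Fin n → F) : (Fin n → F) → ℂ :=
  fun y => ∏ i, φ (x i * y i) / √(Fintype.card F : ℝ)

theorem addChar_dotProduct {F : Type*} [Field F] {m : ℕ} (φ : AddChar F ℂ) (x y : Fin m → F) :
    φ (x ⬝ᵥ y) = ∏ i, φ (x i * y i) := by
  rw [dotProduct]
  induction m with
  | zero => simp
  | succ m ih => rw [Fin.sum_univ_succ, Fin.prod_univ_succ, AddChar.map_add_eq_mul, ← ih]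

theorem sum_addChar_dotProduct (hφ : φ.IsPrimitive) {m : ℕ} (s : Fin m → F) :
    ∑ u : Fin m → F, φ (u ⬝ᵥ s) = if s = 0 then (Fintype.card F : ℂ) ^ m else 0 := by
  simp_rw [addChar_dotProduct]
  have := Finset.prod_univ_sum (fun _ : Fin m => (Finset.univ : Finset F))
    (fun i x => φ (x * s i))
  rw [Fintype.piFinset_univ] at this
  rw [← this]
  simp_rw [sum_addChar_mul hφ]
  split_ifs with h
  · simp [h]
  · obtain ⟨i, hi⟩ := Function.ne_iff.1 h
    exact Finset.prod_eq_zero (Finset.mem_univ i) (if_neg hi)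

theorem charVec_eq {F : Type*} [Field F] [Fintype F] (φ : AddChar F ℂ) (x y : Fin n → F) :
    charVec φ x y = φ (x ⬝ᵥ y) / √(Fintype.card F : ℝ) ^ n := by
  rw [charVec, Finset.prod_div_distrib, addChar_dotProduct]
  simp

theorem charVec_orthonormal (hφ : φ.IsPrimitive) (x x' : Fin n → F) :
    star (charVec φ x) ⬝ᵥ charVec φ x' = if x = x' then 1 else 0 := by
  have hq := two_le_card_cast F
  have hr : ((√(Fintype.card F : ℝ) : ℂ)) ^ 2 = Fintype.card F := by
    exact_mod_cast Real.sq_sqrt (show (0 : ℝ) ≤ Fintype.card F by linarith)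
  have hne : (Fintype.card F : ℂ) ^ n ≠ 0 := by
    have : (Fintype.card F : ℂ) ≠ 0 := by exact_mod_cast Fintype.card_ne_zero
    positivity
  have : ∀ y, star (charVec φ x) y * charVec φ x' y =
      φ (y ⬝ᵥ (x' - x)) / (Fintype.card F : ℂ) ^ n := by
    intro y
    rw [Pi.star_apply, charVec_eq, charVec_eq, star_div₀, star_pow, RCLike.star_def,
      ← AddChar.map_neg_eq_conj, Complex.conj_ofReal, div_mul_div_comm,
      ← AddChar.map_add_eq_mul, ← mul_pow, ← sq, hr, dotProduct_sub, dotProduct_comm y x',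
      dotProduct_comm y x, neg_add_eq_sub]
  rw [dotProduct]
  simp_rw [this]
  rw [← Finset.sum_div, sum_addChar_dotProduct hφ]
  simp only [sub_eq_zero, eq_comm (a := x')]
  split_ifs
  · exact div_self hne
  · simp

theorem state_eq_sum (hφ : φ.IsPrimitive) {ω : ℝ} (h0 : 0 ≤ ω)
    (h1 : ω ≤ ((Fintype.card F : ℝ) - 1) / Fintype.card F) (c : Fin n → F) :
    state ω c = ∑ x : Fin n → F,
      ((amplitude (perp (Fintype.card F) ω) x : ℂ) * φ (-(x ⬝ᵥ c))) • charVec φ x := by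
  have hτ0 := perp_nonneg (Fintype.card F) ω
  have hτ1 := le_one_of_mem two_le_card (perp_le two_le_card h0 h1)
  funext y
  rw [state, amplitude_eq_prod h0 (le_one_of_mem two_le_card h1), Finset.sum_apply]
  push_cast
  simp_rw [sqrt_letterProb_eq hφ h0 h1]
  -- The product over coordinates of one-letter Fourier sums opens into a single sum over all
  -- frequencies in `F^n`.
  rw [Finset.prod_univ_sum, Fintype.piFinset_univ]
  refine Finset.sum_congr rfl fun x _ => ?_
  rw [Finset.prod_mul_distrib, amplitude_eq_prod hτ0 hτ1, Pi.smul_apply, smul_eq_mul,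
    Finset.prod_div_distrib, ← addChar_dotProduct, charVec_eq, dotProduct_sub,
    sub_eq_add_neg, AddChar.map_add_eq_mul]
  push_cast
  simp
  ring

end Letter

/-! ### Quadratic forms and measurements -/

section Quadratic

variable {X ι : Type*} [Fintype X]

theorem outcomeProb_eq (ψ : X → ℂ) (M : Matrix X X ℂ) :
    outcomeProb ψ M = (star ψ ⬝ᵥ M *ᵥ ψ).re := by
  rw [outcomeProb, ketbra, vecMulVec_mul, trace_vecMulVec, dotProduct_comm, dotProduct_mulVec]

theorem outcomeProb_nonneg {M : Matrix X X ℂ} (hM : M.PosSemidef) (ψ : X → ℂ) :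
    0 ≤ outcomeProb ψ M := by
  rw [outcomeProb_eq]
  exact hM.re_dotProduct_nonneg ψ

theorem outcomeProb_sub (ψ : X → ℂ) (M N : Matrix X X ℂ) :
    outcomeProb ψ (M - N) = outcomeProb ψ M - outcomeProb ψ N := by
  simp [outcomeProb, mul_sub]

theorem outcomeProb_sum (ψ : X → ℂ) (s : Finset ι) (M : ι → Matrix X X ℂ) :
    outcomeProb ψ (∑ i ∈ s, M i) = ∑ i ∈ s, outcomeProb ψ (M i) := by
  simp [outcomeProb, Finset.mul_sum, Matrix.trace_sum]

theorem outcomeProb_one [DecidableEq X] (ψ : X → ℂ) :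
    outcomeProb ψ 1 = (star ψ ⬝ᵥ ψ).re := by
  rw [outcomeProb_eq, one_mulVec]

/-- Parallelogram law for the positive form of `M`, dropping the term of `α - β`. -/
theorem outcomeProb_add_le {M : Matrix X X ℂ} (hM : M.PosSemidef) (α β : X → ℂ) :
    outcomeProb (α + β) M ≤ 2 * outcomeProb α M + 2 * outcomeProb β M := by
  have h := outcomeProb_nonneg hM (α - β)
  have e : outcomeProb (α + β) M + outcomeProb (α - β) M =
      2 * outcomeProb α M + 2 * outcomeProb β M := by
    simp only [outcomeProb_eq, star_add, star_sub, mulVec_add, mulVec_sub, add_dotProduct,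
      sub_dotProduct, dotProduct_add, dotProduct_sub, Complex.add_re, Complex.sub_re]
    ring
  linarith

theorem outcomeProb_conjTranspose_mul_self (B : Matrix X X ℂ) (ψ : X → ℂ) :
    outcomeProb ψ (Bᴴ * B) = ∑ j, ‖(B *ᵥ ψ) j‖ ^ 2 := by
  rw [outcomeProb_eq, ← mulVec_mulVec, dotProduct_mulVec, vecMul_conjTranspose, star_star,
    dotProduct, Complex.re_sum]
  refine Finset.sum_congr rfl fun j _ => ?_
  rw [Pi.star_apply, RCLike.star_def, ← Complex.normSq_eq_conj_mul_self, Complex.ofReal_re,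
    Complex.normSq_eq_norm_sq]

theorem exists_eq_conjTranspose_mul_self [DecidableEq X] {M : Matrix X X ℂ} (hM : M.PosSemidef) :
    ∃ B : Matrix X X ℂ, M = Bᴴ * B := by
  open scoped MatrixOrder in
  exact CStarAlgebra.nonneg_iff_eq_star_mul_self.1 hM.nonneg

/-- Cauchy–Schwarz in each coordinate after writing `M = Bᴴ B`. The right side separates the
coefficients from the vectors, which lets `codeSuccess_le` sum over messages with the vectors fixed.
-/
theorem outcomeProb_sum_smul_le [DecidableEq X] {M : Matrix X X ℂ} (hM : M.PosSemidef)
    (T : Finset ι) (a : ι → ℂ) (e : ι → X → ℂ) :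
    outcomeProb (∑ x ∈ T, a x • e x) M ≤ (∑ x ∈ T, ‖a x‖ ^ 2) * ∑ x ∈ T, outcomeProb (e x) M := by
  obtain ⟨B, rfl⟩ := exists_eq_conjTranspose_mul_self hM
  simp only [outcomeProb_conjTranspose_mul_self]
  rw [Finset.sum_comm, Finset.mul_sum]
  refine Finset.sum_le_sum fun j _ => ?_
  have h1 : (B *ᵥ ∑ x ∈ T, a x • e x) j = ∑ x ∈ T, a x * (B *ᵥ e x) j := by
    rw [mulVec_sum, Finset.sum_apply]
    simp [mulVec_smul]
  rw [h1]
  refine le_trans (pow_le_pow_left₀ (norm_nonneg _) (norm_sum_le _ _) 2) ?_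
  simp only [norm_mul]
  exact Finset.sum_mul_sq_le_sq_mul_sq _ _ _

/-- Positive semidefinite operators whose sum is at most the identity. -/
def IsSubPOVM [DecidableEq X] [Fintype ι] (N : ι → Matrix X X ℂ) : Prop :=
  (∀ i, (N i).PosSemidef) ∧ (1 - ∑ i, N i).PosSemidef

variable [DecidableEq X] [Fintype ι]

theorem IsSubPOVM.sum_outcomeProb_le {N : ι → Matrix X X ℂ} (hN : IsSubPOVM N) (ψ : X → ℂ) :
    ∑ i, outcomeProb ψ (N i) ≤ (star ψ ⬝ᵥ ψ).re := by
  have := outcomeProb_nonneg hN.2 ψ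
  rw [outcomeProb_sub, outcomeProb_sum, outcomeProb_one] at this
  linarith

theorem IsSubPOVM.outcomeProb_le {N : ι → Matrix X X ℂ} (hN : IsSubPOVM N) (ψ : X → ℂ) (i : ι) :
    outcomeProb ψ (N i) ≤ (star ψ ⬝ᵥ ψ).re :=
  (Finset.single_le_sum (fun j _ => outcomeProb_nonneg (hN.1 j) ψ) (Finset.mem_univ i)).trans
    (hN.sum_outcomeProb_le ψ)

/-- Used both to restrict a measurement of `F^n` to the codewords and to index the codewords by
messages. -/
theorem IsSubPOVM.comp_injective {κ : Type*} [Fintype κ] {N : ι → Matrix X X ℂ}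
    (hN : IsSubPOVM N) {g : κ → ι} (hg : Function.Injective g) : IsSubPOVM fun j => N (g j) := by
  classical
  refine ⟨fun j => hN.1 _, ?_⟩
  have h : ∑ j, N (g j) = ∑ i ∈ Finset.univ.image g, N i :=
    (Finset.sum_image fun a _ b _ h => hg h).symm
  have h' : 1 - ∑ j, N (g j) = (1 - ∑ i, N i) + ∑ i ∈ (Finset.univ.image g)ᶜ, N i := by
    rw [h, ← Finset.sum_add_sum_compl (Finset.univ.image g) N]
    abel
  rw [h']
  exact hN.2.add (Matrix.posSemidef_sum _ fun i _ => hN.1 i)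

theorem IsPOVM.isSubPOVM {N : ι → Matrix X X ℂ} (hN : IsPOVM N) : IsSubPOVM N :=
  ⟨hN.1, by rw [hN.2, sub_self]; exact Matrix.PosSemidef.zero⟩

end Quadratic

/-! ### Functional calculus and the pretty good measurement -/

section PrettyGood

variable {X ι : Type*} [Fintype X] [DecidableEq X]

/-- In an eigenbasis of `A`, a coordinate of `v` is nonzero only where the eigenvalue equals `t`,
and there `cfc g A` multiplies by `g t`. -/
theorem cfc_mulVec_of_eigenvector {A : Matrix X X ℂ} (hA : A.IsHermitian) (g : ℝ → ℝ) {v : X → ℂ}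
    {t : ℝ} (hv : A *ᵥ v = (t : ℂ) • v) : cfc g A *ᵥ v = (g t : ℂ) • v := by
  set U := hA.eigenvectorUnitary with hU
  have h1 : (U : Matrix X X ℂ) * star (U : Matrix X X ℂ) = 1 := Unitary.coe_mul_star_self U
  have h2 : star (U : Matrix X X ℂ) * (U : Matrix X X ℂ) = 1 := Unitary.coe_star_mul_self U
  set w := star (U : Matrix X X ℂ) *ᵥ v with hw
  have hUw : (U : Matrix X X ℂ) *ᵥ w = v := by rw [hw, mulVec_mulVec, h1, one_mulVec]
  have hdiag : ∀ i, (hA.eigenvalues i : ℂ) * w i = t * w i := by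
    intro i
    have h3 : star (U : Matrix X X ℂ) *ᵥ (A *ᵥ v) = (t : ℂ) • w := by
      rw [hv, mulVec_smul]
    rw [mulVec_mulVec] at h3
    have h4 : star (U : Matrix X X ℂ) * A =
        diagonal (RCLike.ofReal ∘ hA.eigenvalues) * star (U : Matrix X X ℂ) := by
      conv_lhs => rw [hA.spectral_theorem, Unitary.conjStarAlgAut_apply]
      rw [← mul_assoc, ← mul_assoc, ← hU, h2, one_mul]
    rw [h4, ← mulVec_mulVec] at h3
    have h5 := congrFun h3 i
    rw [mulVec_diagonal] at h5
    exact h5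
  rw [hA.cfc_eq, IsHermitian.cfc, Unitary.conjStarAlgAut_apply, ← mulVec_mulVec, ← mulVec_mulVec,
    ← hU, ← hw]
  have : diagonal (RCLike.ofReal ∘ g ∘ hA.eigenvalues) *ᵥ w = (g t : ℂ) • w := by
    funext i
    rw [mulVec_diagonal]
    simp only [Function.comp_apply, Pi.smul_apply, smul_eq_mul]
    by_cases h0 : w i = 0
    · simp [h0]
    · have := mul_right_cancel₀ h0 (hdiag i)
      rw [Complex.ofReal_inj] at this
      rw [this]
      rfl
  rw [this, mulVec_smul, hUw]

theorem ketbra_posSemidef (ψ : X → ℂ) : (ketbra ψ).PosSemidef := posSemidef_vecMulVec_self_star ψ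

theorem ketbra_mulVec (ψ v : X → ℂ) : ketbra ψ *ᵥ v = (star ψ ⬝ᵥ v) • ψ := by
  rw [ketbra, vecMulVec_mulVec, op_smul_eq_smul]

theorem invSqrt_isHermitian (A : Matrix X X ℂ) : (invSqrt A).IsHermitian :=
  cfc_predicate (p := IsSelfAdjoint) (fun x : ℝ => (√x)⁻¹) A

/-- The sandwich is the functional calculus of a function equal to 1 on positive reals and 0 at 0:
the projection onto the support of `A`. -/
theorem invSqrt_sandwich_le {A : Matrix X X ℂ} (hA : A.PosSemidef) :
    (1 - invSqrt A * A * invSqrt A).PosSemidef := by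
  open scoped MatrixOrder in
  have hA' : IsSelfAdjoint A := hA.1
  -- The spectrum is finite, so the discontinuity of `x ↦ (√x)⁻¹` at 0 does no harm.
  have hc : ∀ g : ℝ → ℝ, ContinuousOn g (spectrum ℝ A) := fun g =>
    A.finite_real_spectrum.continuousOn g
  have h : invSqrt A * A * invSqrt A = cfc (fun x : ℝ => (√x)⁻¹ * x * (√x)⁻¹) A := by
    rw [cfc_mul _ _ A (hc _) (hc _), cfc_mul _ _ A (hc _) (hc _), cfc_id' ℝ A]
    rfl
  rw [h, ← Matrix.le_iff]
  refine cfc_le_one _ _ fun x _ => ?_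
  rcases le_or_gt x 0 with hx | hx
  · simp [Real.sqrt_eq_zero_of_nonpos hx]
  · have := Real.sqrt_pos.2 hx
    have h2 := Real.mul_self_sqrt hx.le
    refine le_of_eq ?_
    field_simp
    linarith

variable [Fintype ι]

theorem ensembleSum_posSemidef (ψ : ι → X → ℂ) : (ensembleSum ψ).PosSemidef :=
  Matrix.posSemidef_sum _ fun i _ => ketbra_posSemidef (ψ i)

theorem pgm_isSubPOVM (ψ : ι → X → ℂ) : IsSubPOVM (pgm ψ) := by
  have hH := invSqrt_isHermitian (ensembleSum ψ)
  refine ⟨fun i => ?_, ?_⟩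
  · have := (ketbra_posSemidef (ψ i)).mul_mul_conjTranspose_same (invSqrt (ensembleSum ψ))
    rwa [hH.eq] at this
  · have : ∑ i, pgm ψ i = invSqrt (ensembleSum ψ) * ensembleSum ψ * invSqrt (ensembleSum ψ) := by
      simp only [pgm]
      rw [← Finset.sum_mul, ← Finset.mul_sum]
      rfl
    rw [this]
    exact invSqrt_sandwich_le (ensembleSum_posSemidef ψ)

theorem outcomeProb_pgm (ψ : ι → X → ℂ) (i : ι) {t : ℝ}
    (h : star (ψ i) ⬝ᵥ invSqrt (ensembleSum ψ) *ᵥ ψ i = t) :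
    outcomeProb (ψ i) (pgm ψ i) = t ^ 2 := by
  rw [outcomeProb_eq, pgm, ← mulVec_mulVec, ← mulVec_mulVec, ketbra_mulVec, h, mulVec_smul,
    dotProduct_smul, h, smul_eq_mul, ← Complex.ofReal_mul, Complex.ofReal_re, sq]

end PrettyGood

/-! ### Linear codes: syndromes and the success probability for a fixed code -/

section Code

variable {F : Type*} [Field F] [Fintype F] [DecidableEq F] {k n : ℕ} {φ : AddChar F ℂ}

theorem dotProduct_sum_charVec (hφ : φ.IsPrimitive) (S S' : Finset (Fin n → F))
    (a b : (Fin n → F) → ℂ) :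
    star (∑ x ∈ S, a x • charVec φ x) ⬝ᵥ (∑ x ∈ S', b x • charVec φ x) =
      ∑ x ∈ S, if x ∈ S' then star (a x) * b x else 0 := by
  rw [star_sum, sum_dotProduct]
  refine Finset.sum_congr rfl fun x _ => ?_
  rw [dotProduct_sum]
  simp_rw [star_smul, smul_dotProduct, dotProduct_smul, charVec_orthonormal hφ, smul_eq_mul,
    mul_ite, mul_one, mul_zero]
  rw [Finset.sum_ite_eq]

/-- The part of the Fourier expansion of the states that lies over the syndrome `s`. -/
def syndromeVec (φ : AddChar F ℂ) (τ : ℝ) (G : Matrix (Fin k) (Fin n) F) (s : Fin k → F) :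
    (Fin n → F) → ℂ :=
  ∑ x with G *ᵥ x = s, (amplitude τ x : ℂ) • charVec φ x

/-- The probability that a random error lies in `T` and has syndrome `s`. -/
def syndromeProb (τ : ℝ) (G : Matrix (Fin k) (Fin n) F) (T : Finset (Fin n → F))
    (s : Fin k → F) : ℝ :=
  ∑ x ∈ T with G *ᵥ x = s, prodProb (letterProb τ) x

theorem syndromeProb_nonneg {τ : ℝ} (h0 : 0 ≤ τ) (h1 : τ ≤ 1) (G : Matrix (Fin k) (Fin n) F)
    (T : Finset (Fin n → F)) (s : Fin k → F) : 0 ≤ syndromeProb τ G T s :=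
  Finset.sum_nonneg fun x _ => prodProb_nonneg (letterProb_nonneg h0 h1) x

theorem syndromeProb_mono {τ : ℝ} (h0 : 0 ≤ τ) (h1 : τ ≤ 1) (G : Matrix (Fin k) (Fin n) F)
    (T : Finset (Fin n → F)) (s : Fin k → F) :
    syndromeProb τ G T s ≤ syndromeProb τ G Finset.univ s :=
  Finset.sum_le_sum_of_subset_of_nonneg (Finset.filter_subset_filter _ (Finset.subset_univ _))
    fun x _ _ => prodProb_nonneg (letterProb_nonneg h0 h1) x

theorem sum_syndromeProb (τ : ℝ) (G : Matrix (Fin k) (Fin n) F) (T : Finset (Fin n → F)) :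
    ∑ s, syndromeProb τ G T s = ∑ x ∈ T, prodProb (letterProb τ) x :=
  Finset.sum_fiberwise T (fun x => G *ᵥ x) _

/-- Two errors share a syndrome exactly when `G` kills their difference. This form of the collision
probability can be averaged over `G` pair by pair. -/
theorem sum_syndromeProb_sq (τ : ℝ) (G : Matrix (Fin k) (Fin n) F) (T : Finset (Fin n → F)) :
    ∑ s, syndromeProb τ G T s ^ 2 = ∑ x ∈ T, ∑ y ∈ T,
      if G *ᵥ (x - y) = 0 then prodProb (letterProb τ) x * prodProb (letterProb τ) y else 0 := by
  have h : ∀ s, syndromeProb τ G T s ^ 2 = ∑ x ∈ T with G *ᵥ x = s, ∑ y ∈ T,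
      if G *ᵥ (x - y) = 0 then prodProb (letterProb τ) x * prodProb (letterProb τ) y else 0 := by
    intro s
    rw [sq, syndromeProb, Finset.sum_mul_sum]
    refine Finset.sum_congr rfl fun x hx => ?_
    rw [Finset.sum_filter]
    refine Finset.sum_congr rfl fun y _ => ?_
    refine if_congr ?_ rfl rfl
    rw [mulVec_sub, (Finset.mem_filter.1 hx).2, sub_eq_zero, eq_comm]
  simp_rw [h]
  exact Finset.sum_fiberwise T (fun x => G *ᵥ x) _

theorem syndromeVec_dotProduct (hφ : φ.IsPrimitive) {τ : ℝ} (h0 : 0 ≤ τ) (h1 : τ ≤ 1)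
    (G : Matrix (Fin k) (Fin n) F) (s t : Fin k → F) :
    star (syndromeVec φ τ G s) ⬝ᵥ syndromeVec φ τ G t =
      if s = t then (syndromeProb τ G Finset.univ s : ℂ) else 0 := by
  rw [syndromeVec, syndromeVec, dotProduct_sum_charVec hφ]
  split_ifs with h
  · subst h
    rw [syndromeProb]
    push_cast
    refine Finset.sum_congr rfl fun x hx => ?_
    rw [if_pos hx, RCLike.star_def, Complex.conj_ofReal, ← sq, ← amplitude_sq h0 h1]
    push_cast
    rfl
  · refine Finset.sum_eq_zero fun x hx => if_neg fun hx' => h ?_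
    rw [← (Finset.mem_filter.1 hx).2, (Finset.mem_filter.1 hx').2]

theorem state_eq_sum_syndromeVec (hφ : φ.IsPrimitive) {ω : ℝ} (h0 : 0 ≤ ω)
    (h1 : ω ≤ ((Fintype.card F : ℝ) - 1) / Fintype.card F) (G : Matrix (Fin k) (Fin n) F)
    (u : Fin k → F) :
    state ω (u ᵥ* G) = ∑ s, φ (-(u ⬝ᵥ s)) • syndromeVec φ (perp (Fintype.card F) ω) G s := by
  rw [state_eq_sum hφ h0 h1]
  have h : ∀ s, φ (-(u ⬝ᵥ s)) • syndromeVec φ (perp (Fintype.card F) ω) G s =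
      ∑ x with G *ᵥ x = s, ((amplitude (perp (Fintype.card F) ω) x : ℂ) *
        φ (-(x ⬝ᵥ (u ᵥ* G)))) • charVec φ x := by
    intro s
    rw [syndromeVec, Finset.smul_sum]
    refine Finset.sum_congr rfl fun x hx => ?_
    rw [smul_smul, ← (Finset.mem_filter.1 hx).2, dotProduct_mulVec, dotProduct_comm x, mul_comm]
  simp_rw [h]
  exact (Finset.sum_fiberwise Finset.univ (fun x => G *ᵥ x) _).symm

theorem star_addChar_neg (φ : AddChar F ℂ) (a : F) : star (φ (-a)) = φ a := by
  rw [RCLike.star_def, ← AddChar.map_neg_eq_conj, neg_neg]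

/-- Each projector sends `v_s` to a combination of all `v_t` with phases `φ(u·(s-t))`; summing over
`u` leaves only `t = s`. The sum runs over messages, so no injectivity is needed here. -/
theorem ensembleSum_mulVec_syndromeVec (hφ : φ.IsPrimitive) {ω : ℝ} (h0 : 0 ≤ ω)
    (h1 : ω ≤ ((Fintype.card F : ℝ) - 1) / Fintype.card F) (G : Matrix (Fin k) (Fin n) F)
    (s : Fin k → F) :
    ensembleSum (fun u : Fin k → F => state ω (u ᵥ* G)) *ᵥ
        syndromeVec φ (perp (Fintype.card F) ω) G s =
      (((Fintype.card F : ℝ) ^ k * syndromeProb (perp (Fintype.card F) ω) G Finset.univ s : ℝ) : ℂ)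
        • syndromeVec φ (perp (Fintype.card F) ω) G s := by
  have hτ0 := perp_nonneg (Fintype.card F) ω
  have hτ1 := le_one_of_mem two_le_card (perp_le two_le_card h0 h1)
  set τ := perp (Fintype.card F) ω
  set p := syndromeProb τ G Finset.univ s
  have hu : ∀ u : Fin k → F, ketbra (state ω (u ᵥ* G)) *ᵥ syndromeVec φ τ G s =
      ∑ t, (p * φ (u ⬝ᵥ (s - t))) • syndromeVec φ τ G t := by
    intro u
    have hdot : star (state ω (u ᵥ* G)) ⬝ᵥ syndromeVec φ τ G s = φ (u ⬝ᵥ s) * p := by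
      rw [state_eq_sum_syndromeVec hφ h0 h1, star_sum, sum_dotProduct]
      simp_rw [star_smul, smul_dotProduct]
      rw [Finset.sum_eq_single s]
      · rw [syndromeVec_dotProduct hφ hτ0 hτ1, if_pos rfl, star_addChar_neg, smul_eq_mul]
      · intro t _ hts
        rw [syndromeVec_dotProduct hφ hτ0 hτ1, if_neg hts, smul_zero]
      · exact fun h => absurd (Finset.mem_univ _) h
    rw [ketbra_mulVec, hdot, state_eq_sum_syndromeVec hφ h0 h1, Finset.smul_sum]
    refine Finset.sum_congr rfl fun t _ => ?_
    rw [smul_smul, dotProduct_sub, sub_eq_add_neg, AddChar.map_add_eq_mul]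
    congr 1
    ring
  rw [ensembleSum, sum_mulVec]
  simp_rw [hu]
  rw [Finset.sum_comm, Finset.sum_eq_single s]
  · rw [← Finset.sum_smul, ← Finset.mul_sum, sum_addChar_dotProduct hφ, if_pos (sub_self s)]
    push_cast
    rw [mul_comm]
  · intro t _ hts
    rw [← Finset.sum_smul, ← Finset.mul_sum, sum_addChar_dotProduct hφ,
      if_neg (sub_ne_zero.2 (Ne.symm hts)), mul_zero, zero_smul]
  · exact fun h => absurd (Finset.mem_univ _) h

theorem encode_bijective {G : Matrix (Fin k) (Fin n) F}
    (hG : Function.Injective fun u : Fin k → F => u ᵥ* G) : Function.Bijective (encode G) := by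
  refine ⟨fun u v h => hG (congrArg Subtype.val h), fun c => ?_⟩
  obtain ⟨u, _, hu⟩ := Finset.mem_image.1 c.2
  exact ⟨u, Subtype.ext hu⟩

/-- The success probability for the code generated by `G`. -/
def codeSuccess (ω : ℝ) (G : Matrix (Fin k) (Fin n) F)
    (N : codewords G → Matrix (Fin n → F) (Fin n → F) ℂ) : ℝ :=
  (∑ u : Fin k → F, outcomeProb (state ω (encode G u).1) (N (encode G u))) /
    Fintype.card (Fin k → F)

theorem card_pos_cast : (0 : ℝ) < Fintype.card F := by exact_mod_cast Fintype.card_pos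

theorem state_norm {ω : ℝ} (h0 : 0 ≤ ω) (h1 : ω ≤ 1) (c : Fin n → F) :
    (star (state ω c) ⬝ᵥ state ω c).re = 1 := by
  have h : ∀ y, star (state ω c) y * state ω c y =
      ((prodProb (letterProb ω) (y - c) : ℝ) : ℂ) := by
    intro y
    rw [Pi.star_apply, state, RCLike.star_def, Complex.conj_ofReal, ← amplitude_sq h0 h1]
    push_cast
    ring
  rw [dotProduct]
  simp_rw [h]
  rw [← Complex.ofReal_sum, Complex.ofReal_re]
  exact (Equiv.sum_comp (Equiv.subRight c) (prodProb (letterProb ω))).trans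
    (sum_prodProb (sum_letterProb ω) n)

theorem codeSuccess_nonneg (ω : ℝ) {G : Matrix (Fin k) (Fin n) F}
    {N : codewords G → Matrix (Fin n → F) (Fin n → F) ℂ} (hN : IsSubPOVM N) :
    0 ≤ codeSuccess ω G N :=
  div_nonneg (Finset.sum_nonneg fun _ _ => outcomeProb_nonneg (hN.1 _) _) (Nat.cast_nonneg _)

theorem codeSuccess_le_one {ω : ℝ} (h0 : 0 ≤ ω) (h1 : ω ≤ 1) {G : Matrix (Fin k) (Fin n) F}
    {N : codewords G → Matrix (Fin n → F) (Fin n → F) ℂ} (hN : IsSubPOVM N) :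
    codeSuccess ω G N ≤ 1 := by
  refine div_le_one_of_le₀ ?_ (Nat.cast_nonneg _)
  refine (Finset.sum_le_sum fun _ _ => (hN.outcomeProb_le _ _).trans (state_norm h0 h1 _).le).trans
    ?_
  simp

/-- With `y = √(K p')` this is `(3y² - y⁴)/2 ≤ y`, that is `y (y-1)² (y+2) ≥ 0`, an equality at the
uniform value `K p' = 1`. It bounds a sum of square roots below by total mass and collision
probability, and `p' ≤ p` permits restricting to typical errors. -/
theorem pgm_amplitude_bound {K p p' : ℝ} (hK : 0 < K) (hp' : 0 ≤ p') (h : p' ≤ p) :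
    (3 * p' - K * p' ^ 2) / 2 ≤ (√(K * p))⁻¹ * p := by
  have e : (√(K * p))⁻¹ * p = √p / √K := by
    rw [Real.sqrt_mul hK.le]
    rcases (hp'.trans h).eq_or_lt with h0 | h0
    · simp [← h0]
    · have := Real.sq_sqrt h0.le
      have h1 := Real.sqrt_pos.2 h0
      have h2 := Real.sqrt_pos.2 hK
      field_simp
      linarith
  rw [e]
  refine le_trans ?_ (div_le_div_of_nonneg_right (Real.sqrt_le_sqrt h) (Real.sqrt_nonneg K))
  have hK2 := Real.sqrt_pos.2 hK
  rw [le_div_iff₀ hK2]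
  set a := √p'
  set b := √K
  have ha : 0 ≤ a := Real.sqrt_nonneg _
  rw [← Real.sq_sqrt hp', ← Real.sq_sqrt hK.le]
  change (3 * a ^ 2 - b ^ 2 * (a ^ 2) ^ 2) / 2 * b ≤ a
  have : a - (3 * a ^ 2 - b ^ 2 * (a ^ 2) ^ 2) / 2 * b = a * ((a * b - 1) ^ 2 * (a * b + 2)) / 2 := by
    ring
  have : 0 ≤ a * ((a * b - 1) ^ 2 * (a * b + 2)) / 2 := by positivity
  linarith

theorem pgm_codeSuccess_ge {ω : ℝ} (h0 : 0 ≤ ω)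
    (h1 : ω ≤ ((Fintype.card F : ℝ) - 1) / Fintype.card F) {G : Matrix (Fin k) (Fin n) F}
    (hG : Function.Injective fun u : Fin k → F => u ᵥ* G) (T : Finset (Fin n → F)) :
    3 * ∑ x ∈ T, prodProb (letterProb (perp (Fintype.card F) ω)) x - 1 -
        (Fintype.card F : ℝ) ^ k * ∑ s, syndromeProb (perp (Fintype.card F) ω) G T s ^ 2 ≤
      codeSuccess ω G (pgm fun c : codewords G => state ω c.1) := by
  have hφ := AddChar.FiniteField.primitiveChar_to_Complex_isPrimitive F
  set φ := AddChar.FiniteField.primitiveChar_to_Complex F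
  have hτ0 := perp_nonneg (Fintype.card F) ω
  have hτ1 := le_one_of_mem two_le_card (perp_le two_le_card h0 h1)
  have hq := card_pos_cast (F := F)
  set τ := perp (Fintype.card F) ω
  set K : ℝ := (Fintype.card F : ℝ) ^ k with hKdef
  have hK : 0 < K := pow_pos hq k
  set ρ := ensembleSum fun c : codewords G => state ω c.1
  -- Injectivity makes the sum over codewords, which defines the PGM, equal to the sum over
  -- messages.
  have hρ : ρ = ensembleSum (fun u : Fin k → F => state ω (u ᵥ* G)) :=
    ((encode_bijective hG).sum_comp fun c : codewords G => ketbra (state ω c.1)).symm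
  have hinv : ∀ s, invSqrt ρ *ᵥ syndromeVec φ τ G s =
      (((√(K * syndromeProb τ G Finset.univ s))⁻¹ : ℝ) : ℂ) • syndromeVec φ τ G s := by
    intro s
    refine cfc_mulVec_of_eigenvector (ensembleSum_posSemidef _).1 _ ?_
    change ρ *ᵥ _ = _
    rw [hρ]
    exact ensembleSum_mulVec_syndromeVec hφ h0 h1 G s
  set t : ℝ := ∑ s, (√(K * syndromeProb τ G Finset.univ s))⁻¹ * syndromeProb τ G Finset.univ s
    with ht
  have hamp : ∀ u : Fin k → F, star (state ω (u ᵥ* G)) ⬝ᵥ invSqrt ρ *ᵥ state ω (u ᵥ* G) = t := by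
    intro u
    have hst : state ω (u ᵥ* G) = ∑ s, φ (-(u ⬝ᵥ s)) • syndromeVec φ τ G s :=
      state_eq_sum_syndromeVec hφ h0 h1 G u
    rw [hst, star_sum, sum_dotProduct, ht, mulVec_sum]
    push_cast
    refine Finset.sum_congr rfl fun s _ => ?_
    simp_rw [mulVec_smul, hinv]
    rw [dotProduct_sum, Finset.sum_eq_single s]
    · rw [star_smul, smul_dotProduct, dotProduct_smul, dotProduct_smul,
        syndromeVec_dotProduct hφ hτ0 hτ1, if_pos rfl, star_addChar_neg, smul_eq_mul, smul_eq_mul,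
        smul_eq_mul, ← mul_assoc, ← AddChar.map_add_eq_mul, add_neg_cancel,
        AddChar.map_zero_eq_one, one_mul]
      push_cast
      rfl
    · intro s' _ hs
      rw [star_smul, smul_dotProduct, dotProduct_smul, dotProduct_smul,
        syndromeVec_dotProduct hφ hτ0 hτ1, if_neg (Ne.symm hs), smul_zero, smul_zero, smul_zero]
    · exact fun h => absurd (Finset.mem_univ _) h
  have hsucc : codeSuccess ω G (pgm fun c : codewords G => state ω c.1) = t ^ 2 := by
    rw [codeSuccess]
    have : ∀ u, outcomeProb (state ω (encode G u).1)
        (pgm (fun c : codewords G => state ω c.1) (encode G u)) = t ^ 2 := fun u =>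
      outcomeProb_pgm (fun c : codewords G => state ω c.1) (encode G u) (hamp u)
    simp_rw [this]
    rw [Finset.sum_const, Finset.card_univ, nsmul_eq_mul, mul_div_cancel_left₀]
    exact_mod_cast Fintype.card_ne_zero
  have hlow : (3 * ∑ x ∈ T, prodProb (letterProb τ) x - K * ∑ s, syndromeProb τ G T s ^ 2) / 2
      ≤ t := by
    rw [← sum_syndromeProb τ G T, Finset.mul_sum, Finset.mul_sum, ← Finset.sum_sub_distrib,
      Finset.sum_div]
    exact Finset.sum_le_sum fun s _ => pgm_amplitude_bound hK (syndromeProb_nonneg hτ0 hτ1 G T s)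
      (syndromeProb_mono hτ0 hτ1 G T s)
  rw [hsucc]
  -- `t² ≥ 2t - 1` turns the bound on `t` into one that is linear in the collision probability,
  -- ready to be averaged over `G`.
  nlinarith [sq_nonneg (t - 1)]

/-- Split the state into its frequencies in `T` and the rest. The `T` part involves `|T|`
orthonormal characters independent of the message, and the outcome probabilities of each, summed
over all messages, total at most 1. The rest contributes at most its norm. -/
theorem codeSuccess_le {ω : ℝ} (h0 : 0 ≤ ω)
    (h1 : ω ≤ ((Fintype.card F : ℝ) - 1) / Fintype.card F) {G : Matrix (Fin k) (Fin n) F}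
    (hG : Function.Injective fun u : Fin k → F => u ᵥ* G)
    {N : codewords G → Matrix (Fin n → F) (Fin n → F) ℂ} (hN : IsSubPOVM N)
    (T : Finset (Fin n → F)) :
    codeSuccess ω G N ≤ 2 * T.card / (Fintype.card F : ℝ) ^ k +
      2 * ∑ x ∈ Tᶜ, prodProb (letterProb (perp (Fintype.card F) ω)) x := by
  have hφ := AddChar.FiniteField.primitiveChar_to_Complex_isPrimitive F
  set φ := AddChar.FiniteField.primitiveChar_to_Complex F
  have hτ0 := perp_nonneg (Fintype.card F) ω
  have hτ1 := le_one_of_mem two_le_card (perp_le two_le_card h0 h1)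
  have hq := card_pos_cast (F := F)
  set τ := perp (Fintype.card F) ω with hτ
  have hK : (0 : ℝ) < (Fintype.card F : ℝ) ^ k := pow_pos hq k
  have hp := fun x : Fin n → F => prodProb_nonneg (letterProb_nonneg (F := F) hτ0 hτ1) x
  have hnorm : ∀ (u : Fin k → F) x,
      ‖(amplitude τ x : ℂ) * φ (-(x ⬝ᵥ (u ᵥ* G)))‖ ^ 2 = prodProb (letterProb τ) x := by
    intro u x
    rw [norm_mul, AddChar.norm_apply, mul_one, Complex.norm_real, Real.norm_eq_abs, sq_abs,
      amplitude_sq hτ0 hτ1]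
  have hN' := hN.comp_injective (encode_bijective hG).1
  have hu : ∀ u, outcomeProb (state ω (encode G u).1) (N (encode G u)) ≤
      2 * ∑ x ∈ T, outcomeProb (charVec φ x) (N (encode G u)) +
        2 * ∑ x ∈ Tᶜ, prodProb (letterProb τ) x := by
    intro u
    set a : (Fin n → F) → ℂ := fun x => (amplitude τ x : ℂ) * φ (-(x ⬝ᵥ (u ᵥ* G)))
    have hst : state ω (encode G u).1 =
        ∑ x ∈ T, a x • charVec φ x + ∑ x ∈ Tᶜ, a x • charVec φ x := by
      rw [Finset.sum_add_sum_compl]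
      exact state_eq_sum hφ h0 h1 _
    rw [hst]
    refine (outcomeProb_add_le (hN.1 _) _ _).trans (add_le_add ?_ ?_)
    · refine mul_le_mul_of_nonneg_left ?_ zero_le_two
      refine (outcomeProb_sum_smul_le (hN.1 _) T a _).trans ?_
      refine mul_le_of_le_one_left
        (Finset.sum_nonneg fun x _ => outcomeProb_nonneg (hN.1 _) _) ?_
      simp_rw [a, hnorm u]
      rw [← sum_prodProb (sum_letterProb (F := F) τ) n]
      exact Finset.sum_le_sum_of_subset_of_nonneg (Finset.subset_univ _) fun x _ _ => hp x
    · refine mul_le_mul_of_nonneg_left ?_ zero_le_two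
      refine (hN.outcomeProb_le _ _).trans (le_of_eq ?_)
      rw [dotProduct_sum_charVec hφ, Complex.re_sum]
      refine Finset.sum_congr rfl fun x hx => ?_
      rw [if_pos hx, RCLike.star_def, ← Complex.normSq_eq_conj_mul_self, Complex.ofReal_re,
        Complex.normSq_eq_norm_sq, hnorm u]
  have hsum : ∑ u, ∑ x ∈ T, outcomeProb (charVec φ x) (N (encode G u)) ≤ T.card := by
    rw [Finset.sum_comm]
    refine (Finset.sum_le_sum fun x _ => hN'.sum_outcomeProb_le (charVec φ x)).trans ?_
    simp [charVec_orthonormal hφ]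
  have hcard : (Fintype.card (Fin k → F) : ℝ) = (Fintype.card F : ℝ) ^ k := by simp
  rw [codeSuccess, hcard, div_le_iff₀ hK, add_mul, div_mul_cancel₀ _ hK.ne']
  refine (Finset.sum_le_sum fun u _ => hu u).trans ?_
  rw [Finset.sum_add_distrib, ← Finset.mul_sum, Finset.sum_const, Finset.card_univ, nsmul_eq_mul,
    hcard, mul_comm ((Fintype.card F : ℝ) ^ k)]
  linarith

end Code

/-! ### Averaging over random codes -/

section RandomCode

theorem card_eq_card_mul_card_ker {A B : Type*} [AddGroup A] [AddGroup B] [Fintype A] [Fintype B]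
    [DecidableEq B] (f : A →+ B) (hf : Function.Surjective f) :
    Fintype.card A = Fintype.card B * (Finset.univ.filter fun a => f a = 0).card := by
  have h := AddSubgroup.card_eq_card_quotient_mul_card_addSubgroup f.ker
  rw [Nat.card_congr (QuotientAddGroup.quotientKerEquivOfSurjective f hf).toEquiv,
    Nat.card_eq_fintype_card, Nat.card_eq_fintype_card] at h
  rw [h]
  congr 1
  rw [Nat.card_eq_fintype_card, Fintype.card_subtype]
  simp only [AddMonoidHom.mem_ker]

variable {F : Type*} [Field F] [Fintype F] [DecidableEq F] {k n : ℕ}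

/-- `G ↦ G z` is a surjective homomorphism, rank-one matrices already reaching every vector, so its
fibres all have the size of its kernel. -/
theorem card_matrix_mulVec_eq_zero {z : Fin n → F} (hz : z ≠ 0) :
    (Fintype.card (Matrix (Fin k) (Fin n) F) : ℝ) = (Fintype.card F : ℝ) ^ k *
      (Finset.univ.filter fun G : Matrix (Fin k) (Fin n) F => G *ᵥ z = 0).card := by
  obtain ⟨j, hj⟩ := Function.ne_iff.1 hz
  have h := card_eq_card_mul_card_ker (A := Matrix (Fin k) (Fin n) F) (B := Fin k → F)
    ⟨⟨fun G => G *ᵥ z, zero_mulVec z⟩, fun G G' => add_mulVec G G' z⟩ (fun w => by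
      refine ⟨vecMulVec w (Pi.single j (z j)⁻¹), ?_⟩
      change vecMulVec w (Pi.single j (z j)⁻¹) *ᵥ z = w
      rw [vecMulVec_mulVec, single_dotProduct, inv_mul_cancel₀ hj, op_smul_eq_smul, one_smul])
  rw [h]
  simp

theorem card_matrix_vecMul_eq_zero {u : Fin k → F} (hu : u ≠ 0) :
    (Fintype.card (Matrix (Fin k) (Fin n) F) : ℝ) = (Fintype.card F : ℝ) ^ n *
      (Finset.univ.filter fun G : Matrix (Fin k) (Fin n) F => u ᵥ* G = 0).card := by
  obtain ⟨j, hj⟩ := Function.ne_iff.1 hu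
  have h := card_eq_card_mul_card_ker (A := Matrix (Fin k) (Fin n) F) (B := Fin n → F)
    ⟨⟨fun G => u ᵥ* G, vecMul_zero u⟩, fun G G' => vecMul_add G G' u⟩ (fun w => by
      refine ⟨vecMulVec (Pi.single j (u j)⁻¹) w, ?_⟩
      change u ᵥ* vecMulVec (Pi.single j (u j)⁻¹) w = w
      rw [vecMul_vecMulVec, dotProduct_single, mul_inv_cancel₀ hj, one_smul])
  rw [h]
  simp

open Classical in
variable (F k n) in
/-- The matrices for which two messages share a codeword. -/
def degenerate : Finset (Matrix (Fin k) (Fin n) F) :=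
  Finset.univ.filter fun G => ¬ Function.Injective fun u : Fin k → F => u ᵥ* G

theorem card_matrix_pos : (0 : ℝ) < Fintype.card (Matrix (Fin k) (Fin n) F) := by
  exact_mod_cast Fintype.card_pos

/-- Union bound over nonzero messages `u`, each satisfying `u G = 0` for a fraction `q^{-n}` of the
matrices. -/
theorem card_degenerate_le : ((degenerate F k n).card : ℝ) / Fintype.card (Matrix (Fin k) (Fin n) F)
    ≤ (Fintype.card F : ℝ) ^ k / (Fintype.card F : ℝ) ^ n := by
  have hq := card_pos_cast (F := F)
  have hsub : degenerate F k n ⊆ (Finset.univ.filter fun u : Fin k → F => u ≠ 0).biUnion fun u =>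
      Finset.univ.filter fun G : Matrix (Fin k) (Fin n) F => u ᵥ* G = 0 := by
    intro G hG
    simp only [degenerate, Finset.mem_filter, Finset.mem_univ, true_and] at hG
    simp only [Finset.mem_biUnion, Finset.mem_filter, Finset.mem_univ, true_and]
    by_contra! hcon
    refine hG fun u v huv => ?_
    by_contra hne
    exact hcon (u - v) (sub_ne_zero.2 hne) (by rw [sub_vecMul]; exact sub_eq_zero.2 huv)
  have h1 : ((degenerate F k n).card : ℝ) ≤ ∑ u : Fin k → F with u ≠ 0,
      ((Finset.univ.filter fun G : Matrix (Fin k) (Fin n) F => u ᵥ* G = 0).card : ℝ) := by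
    exact_mod_cast (Finset.card_le_card hsub).trans Finset.card_biUnion_le
  have h2 : ∀ u ∈ (Finset.univ.filter fun u : Fin k → F => u ≠ 0),
      ((Finset.univ.filter fun G : Matrix (Fin k) (Fin n) F => u ᵥ* G = 0).card : ℝ) =
      Fintype.card (Matrix (Fin k) (Fin n) F) / (Fintype.card F : ℝ) ^ n := by
    intro u hu
    rw [card_matrix_vecMul_eq_zero (Finset.mem_filter.1 hu).2,
      mul_div_cancel_left₀ _ (pow_pos hq n).ne']
  rw [Finset.sum_congr rfl h2, Finset.sum_const, nsmul_eq_mul] at h1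
  have h3 : ((Finset.univ.filter fun u : Fin k → F => u ≠ 0).card : ℝ) ≤
      (Fintype.card F : ℝ) ^ k := by
    have : ((Finset.univ.filter fun u : Fin k → F => u ≠ 0).card : ℝ) ≤
        Fintype.card (Fin k → F) := by exact_mod_cast Finset.card_le_univ _
    simpa using this
  rw [div_le_iff₀ card_matrix_pos, div_mul_eq_mul_div, ← mul_div_assoc']
  exact h1.trans (mul_le_mul_of_nonneg_right h3 (by positivity))

theorem success_eq (ω : ℝ) (M : (G : Matrix (Fin k) (Fin n) F) → codewords G →
      Matrix (Fin n → F) (Fin n → F) ℂ) :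
    success ω M = (∑ G, codeSuccess ω G (M G)) / Fintype.card (Matrix (Fin k) (Fin n) F) := rfl

theorem success_nonneg (ω : ℝ) {M : (G : Matrix (Fin k) (Fin n) F) → codewords G →
      Matrix (Fin n → F) (Fin n → F) ℂ} (hM : ∀ G, IsSubPOVM (M G)) : 0 ≤ success ω M :=
  div_nonneg (Finset.sum_nonneg fun G _ => codeSuccess_nonneg ω (hM G)) (Nat.cast_nonneg _)

theorem success_le_one {ω : ℝ} (h0 : 0 ≤ ω) (h1 : ω ≤ 1)
    {M : (G : Matrix (Fin k) (Fin n) F) → codewords G →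
      Matrix (Fin n → F) (Fin n → F) ℂ} (hM : ∀ G, IsSubPOVM (M G)) : success ω M ≤ 1 := by
  refine div_le_one_of_le₀ ?_ (Nat.cast_nonneg _)
  refine (Finset.sum_le_sum fun G _ => codeSuccess_le_one h0 h1 (hM G)).trans ?_
  simp

theorem average_const_add (a b : ℝ) :
    (∑ G : Matrix (Fin k) (Fin n) F, (a + if G ∈ degenerate F k n then b else 0)) /
      Fintype.card (Matrix (Fin k) (Fin n) F) =
      a + b * ((degenerate F k n).card / Fintype.card (Matrix (Fin k) (Fin n) F)) := by
  have := (card_matrix_pos (F := F) (k := k) (n := n)).ne'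
  rw [Finset.sum_add_distrib, Finset.sum_const, Finset.card_univ, nsmul_eq_mul,
    Finset.sum_ite_mem, Finset.univ_inter, Finset.sum_const, nsmul_eq_mul]
  field_simp

theorem injective_of_notMem_degenerate {G : Matrix (Fin k) (Fin n) F}
    (hG : G ∉ degenerate F k n) : Function.Injective fun u : Fin k → F => u ᵥ* G := by
  simpa [degenerate] using hG

theorem success_le {ω : ℝ} (h0 : 0 ≤ ω)
    (h1 : ω ≤ ((Fintype.card F : ℝ) - 1) / Fintype.card F)
    {M : (G : Matrix (Fin k) (Fin n) F) → codewords G →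
      Matrix (Fin n → F) (Fin n → F) ℂ} (hM : ∀ G, IsSubPOVM (M G)) (T : Finset (Fin n → F)) :
    success ω M ≤ 2 * T.card / (Fintype.card F : ℝ) ^ k +
      2 * ∑ x ∈ Tᶜ, prodProb (letterProb (perp (Fintype.card F) ω)) x +
      (Fintype.card F : ℝ) ^ k / (Fintype.card F : ℝ) ^ n := by
  have hτ0 := perp_nonneg (Fintype.card F) ω
  have hτ1 := le_one_of_mem two_le_card (perp_le two_le_card h0 h1)
  have hq := card_pos_cast (F := F)
  set B := 2 * T.card / (Fintype.card F : ℝ) ^ k +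
      2 * ∑ x ∈ Tᶜ, prodProb (letterProb (perp (Fintype.card F) ω)) x with hB
  have hB0 : 0 ≤ B := add_nonneg (by positivity) (mul_nonneg zero_le_two
    (Finset.sum_nonneg fun x _ => prodProb_nonneg (letterProb_nonneg hτ0 hτ1) x))
  have h : ∀ G, codeSuccess ω G (M G) ≤ B + if G ∈ degenerate F k n then 1 else 0 := by
    intro G
    split_ifs with hG
    · linarith [codeSuccess_le_one h0 (le_one_of_mem two_le_card h1) (hM G)]
    · rw [add_zero]
      exact codeSuccess_le h0 h1 (injective_of_notMem_degenerate hG) (hM G) T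
  rw [success_eq]
  refine (div_le_div_of_nonneg_right (Finset.sum_le_sum fun G _ => h G) (Nat.cast_nonneg _)).trans
    ?_
  rw [average_const_add, one_mul]
  exact add_le_add_right card_degenerate_le B

/-- Distinct pairs in `T` collide with probability `1/K`, giving at most 1 after scaling by `K`.
Equal pairs always collide, but `∑ p(x)² ≤ m ∑ p(x) ≤ m`. -/
theorem average_collision_le {τ : ℝ} (hτ0 : 0 ≤ τ) (hτ1 : τ ≤ 1) {T : Finset (Fin n → F)} {m : ℝ}
    (hm0 : 0 ≤ m) (hm : ∀ x ∈ T, prodProb (letterProb τ) x ≤ m) :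
    (∑ G : Matrix (Fin k) (Fin n) F, (Fintype.card F : ℝ) ^ k * ∑ s, syndromeProb τ G T s ^ 2) /
      Fintype.card (Matrix (Fin k) (Fin n) F) ≤ 1 + (Fintype.card F : ℝ) ^ k * m := by
  have hq := card_pos_cast (F := F)
  set K : ℝ := (Fintype.card F : ℝ) ^ k
  have hK : 0 < K := pow_pos hq k
  set W : ℝ := (Fintype.card (Matrix (Fin k) (Fin n) F) : ℝ)
  have hW : 0 < W := card_matrix_pos
  set p : (Fin n → F) → ℝ := fun x => prodProb (letterProb τ) x
  have hp : ∀ x, 0 ≤ p x := fun x => prodProb_nonneg (letterProb_nonneg hτ0 hτ1) x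
  have hT : ∑ x ∈ T, p x ≤ 1 := by
    rw [← sum_prodProb (sum_letterProb (F := F) τ) n]
    exact Finset.sum_le_sum_of_subset_of_nonneg (Finset.subset_univ _) fun x _ _ => hp x
  have hT0 : 0 ≤ ∑ x ∈ T, p x := Finset.sum_nonneg fun x _ => hp x
  have hpair : ∀ x ∈ T, ∀ y ∈ T,
      ∑ G : Matrix (Fin k) (Fin n) F, (if G *ᵥ (x - y) = 0 then p x * p y else 0) ≤
        W / K * (p x * p y) + if x = y then W * (m * p x) else 0 := by
    intro x hx y _
    rw [← Finset.sum_filter, Finset.sum_const, nsmul_eq_mul]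
    split_ifs with hxy
    · subst hxy
      have h1 : W * (p x * p x) ≤ W * (m * p x) :=
        mul_le_mul_of_nonneg_left (mul_le_mul_of_nonneg_right (hm x hx) (hp x)) hW.le
      have h2 : 0 ≤ W / K * (p x * p x) :=
        mul_nonneg (div_nonneg hW.le hK.le) (mul_nonneg (hp x) (hp x))
      have h3 : ((Finset.univ.filter fun G : Matrix (Fin k) (Fin n) F =>
          G *ᵥ (x - x) = 0).card : ℝ) ≤ W := Nat.cast_le.2 (Finset.card_le_univ _)
      have h4 := mul_le_mul_of_nonneg_right h3 (mul_nonneg (hp x) (hp x))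
      linarith
    · rw [add_zero]
      refine le_of_eq ?_
      congr 1
      rw [eq_div_iff hK.ne', mul_comm]
      exact (card_matrix_mulVec_eq_zero (sub_ne_zero.2 hxy)).symm
  have hsum : ∑ G : Matrix (Fin k) (Fin n) F, ∑ s, syndromeProb τ G T s ^ 2 ≤ W / K + W * m := by
    simp_rw [sum_syndromeProb_sq]
    rw [Finset.sum_comm]
    have h1 : ∀ x ∈ T, ∑ G : Matrix (Fin k) (Fin n) F, ∑ y ∈ T,
        (if G *ᵥ (x - y) = 0 then p x * p y else 0) ≤
          W / K * p x * ∑ y ∈ T, p y + W * m * p x := by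
      intro x hx
      rw [Finset.sum_comm]
      refine (Finset.sum_le_sum fun y hy => hpair x hx y hy).trans (le_of_eq ?_)
      rw [Finset.sum_add_distrib, Finset.sum_ite_eq, if_pos hx, Finset.mul_sum]
      simp only [mul_assoc]
    refine (Finset.sum_le_sum h1).trans ?_
    rw [Finset.sum_add_distrib, ← Finset.mul_sum, ← Finset.sum_mul, ← Finset.mul_sum]
    have h2 : W / K * (∑ x ∈ T, p x) * ∑ y ∈ T, p y ≤ W / K := by
      rw [mul_assoc]
      exact mul_le_of_le_one_right (div_nonneg hW.le hK.le) (mul_le_one₀ hT hT0 hT)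
    have h3 : W * m * ∑ x ∈ T, p x ≤ W * m := mul_le_of_le_one_right (mul_nonneg hW.le hm0) hT
    exact add_le_add h2 h3
  rw [← Finset.mul_sum, div_le_iff₀ hW]
  refine (mul_le_mul_of_nonneg_left hsum hK.le).trans (le_of_eq ?_)
  field_simp

theorem le_pgmSuccess {ω : ℝ} (h0 : 0 ≤ ω)
    (h1 : ω ≤ ((Fintype.card F : ℝ) - 1) / Fintype.card F) {T : Finset (Fin n → F)} {m : ℝ}
    (hm0 : 0 ≤ m) (hm : ∀ x ∈ T, prodProb (letterProb (perp (Fintype.card F) ω)) x ≤ m) :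
    1 - 3 * ∑ x ∈ Tᶜ, prodProb (letterProb (perp (Fintype.card F) ω)) x -
        (Fintype.card F : ℝ) ^ k * m - 2 * ((Fintype.card F : ℝ) ^ k / (Fintype.card F : ℝ) ^ n) ≤
      pgmSuccess F k n ω := by
  have hτ0 := perp_nonneg (Fintype.card F) ω
  have hτ1 := le_one_of_mem two_le_card (perp_le two_le_card h0 h1)
  set τ := perp (Fintype.card F) ω
  have hp : ∀ x : Fin n → F, 0 ≤ prodProb (letterProb τ) x :=
    fun x => prodProb_nonneg (letterProb_nonneg hτ0 hτ1) x
  set P := ∑ x ∈ T, prodProb (letterProb τ) x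
  have hPc : P + ∑ x ∈ Tᶜ, prodProb (letterProb τ) x = 1 := by
    rw [Finset.sum_add_sum_compl, sum_prodProb (sum_letterProb τ)]
  have hPc0 : 0 ≤ ∑ x ∈ Tᶜ, prodProb (letterProb τ) x := Finset.sum_nonneg fun x _ => hp x
  -- On degenerate matrices the correction `-2` makes the left side nonpositive, since `P ≤ 1`, so
  -- the bound holds for every `G`.
  have hG : ∀ G : Matrix (Fin k) (Fin n) F,
      (3 * P - 1 + if G ∈ degenerate F k n then (-2) else 0) -
        (Fintype.card F : ℝ) ^ k * ∑ s, syndromeProb τ G T s ^ 2 ≤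
      codeSuccess ω G (pgm fun c : codewords G => state ω c.1) := by
    intro G
    split_ifs with hG
    · have hs : 0 ≤ (Fintype.card F : ℝ) ^ k * ∑ s, syndromeProb τ G T s ^ 2 := by positivity
      have := codeSuccess_nonneg ω (pgm_isSubPOVM fun c : codewords G => state ω c.1)
      linarith
    · rw [add_zero]
      exact pgm_codeSuccess_ge h0 h1 (injective_of_notMem_degenerate hG) T
  have hW := card_matrix_pos (F := F) (k := k) (n := n)
  have hsum := div_le_div_of_nonneg_right (Finset.sum_le_sum fun G (_ : G ∈ Finset.univ) => hG G)
    hW.le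
  rw [Finset.sum_sub_distrib, sub_div, average_const_add] at hsum
  have hcol := average_collision_le (k := k) hτ0 hτ1 hm0 hm
  have hdeg := card_degenerate_le (F := F) (k := k) (n := n)
  rw [pgmSuccess, success_eq]
  linarith

end RandomCode

/-! ### Algorithms from measurements of the codewords -/

section Completion

variable {F : Type*} [Field F] [Fintype F] [DecidableEq F] {k n : ℕ}

theorem sum_dite_codewords (G : Matrix (Fin k) (Fin n) F)
    (N : codewords G → Matrix (Fin n → F) (Fin n → F) ℂ) :
    (∑ x : Fin n → F, if h : x ∈ codewords G then N ⟨x, h⟩ else 0) = ∑ c, N c := by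
  rw [← Finset.sum_subset (Finset.subset_univ (codewords G)) fun x _ hx => dif_neg hx,
    ← Finset.sum_coe_sort]
  exact Finset.sum_congr rfl fun c _ => dif_pos c.2

/-- The algorithm that performs the measurements `N`, and answers `0` on the outcome they omit. -/
def completion (N : (G : Matrix (Fin k) (Fin n) F) → codewords G →
      Matrix (Fin n → F) (Fin n → F) ℂ) (hN : ∀ G, IsSubPOVM (N G)) : Algorithm F k n where
  op G x := (if h : x ∈ codewords G then N G ⟨x, h⟩ else 0) +
    if x = 0 then 1 - ∑ c, N G c else 0
  isPOVM G := by
    refine ⟨fun x => Matrix.PosSemidef.add ?_ ?_, ?_⟩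
    · split_ifs
      exacts [(hN G).1 _, Matrix.PosSemidef.zero]
    · split_ifs
      exacts [(hN G).2, Matrix.PosSemidef.zero]
    · rw [Finset.sum_add_distrib, sum_dite_codewords, Finset.sum_ite_eq',
        if_pos (Finset.mem_univ _), add_sub_cancel]

theorem success_le_completion (ω : ℝ) (N : (G : Matrix (Fin k) (Fin n) F) → codewords G →
      Matrix (Fin n → F) (Fin n → F) ℂ) (hN : ∀ G, IsSubPOVM (N G)) :
    success ω N ≤ (completion N hN).successProb ω := by
  refine div_le_div_of_nonneg_right (Finset.sum_le_sum fun G _ => ?_) (Nat.cast_nonneg _)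
  refine div_le_div_of_nonneg_right (Finset.sum_le_sum fun u _ => ?_) (Nat.cast_nonneg _)
  have h : 0 ≤ outcomeProb (state ω (encode G u).1)
      ((completion N hN).op G (encode G u).1 - N G (encode G u)) := by
    refine outcomeProb_nonneg ?_ _
    simp only [completion, (encode G u).2, dif_pos, Subtype.coe_eta, add_sub_cancel_left]
    split_ifs
    exacts [(hN G).2, Matrix.PosSemidef.zero]
  rw [outcomeProb_sub] at h
  linarith

theorem Algorithm.isSubPOVM (A : Algorithm F k n) (G : Matrix (Fin k) (Fin n) F) :
    IsSubPOVM fun c : codewords G => A.op G c.1 :=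
  (A.isPOVM G).isSubPOVM.comp_injective Subtype.val_injective

end Completion

/-! ### The asymptotic regime -/

section Asymptotics

theorem tendsto_exp_neg_mul_nat {c : ℝ} (hc : 0 < c) :
    Tendsto (fun n : ℕ => Real.exp (-(c * n))) atTop (𝓝 0) :=
  Real.tendsto_exp_neg_atTop_nhds_zero.comp
    (tendsto_natCast_atTop_atTop.const_mul_atTop hc)

theorem pow_eq_exp {a : ℝ} (ha : 0 < a) (m : ℕ) : a ^ m = Real.exp (m * Real.log a) := by
  rw [mul_comm, Real.exp_mul, Real.exp_log ha, Real.rpow_natCast]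

variable {q : ℕ} {R : ℝ}

theorem pow_floor_le (hq : 2 ≤ q) (hR : 0 ≤ R) (n : ℕ) :
    (q : ℝ) ^ ⌊R * (n : ℝ)⌋₊ ≤ Real.exp (R * n * Real.log q) := by
  have h2 : (2 : ℝ) ≤ q := by exact_mod_cast hq
  rw [pow_eq_exp (by linarith)]
  exact Real.exp_le_exp.2 (mul_le_mul_of_nonneg_right (Nat.floor_le (by positivity))
    (Real.log_nonneg (by linarith)))

/-- Rounding `R n` down costs at most one factor `q`, hence the `q` in the upper bound below. -/
theorem exp_le_mul_pow_floor (hq : 2 ≤ q) (n : ℕ) :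
    Real.exp (R * n * Real.log q) ≤ q * (q : ℝ) ^ ⌊R * (n : ℝ)⌋₊ := by
  have h2 : (2 : ℝ) ≤ q := by exact_mod_cast hq
  rw [← pow_succ', pow_eq_exp (by linarith)]
  refine Real.exp_le_exp.2 (mul_le_mul_of_nonneg_right ?_ (Real.log_nonneg (by linarith)))
  push_cast
  exact (Nat.lt_floor_add_one _).le

theorem tendsto_pow_floor_div_pow (hq : 2 ≤ q) (hR0 : 0 ≤ R) (hR1 : R < 1) :
    Tendsto (fun n : ℕ => (q : ℝ) ^ ⌊R * (n : ℝ)⌋₊ / (q : ℝ) ^ n) atTop (𝓝 0) := by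
  have h2 : (2 : ℝ) ≤ q := by exact_mod_cast hq
  have hl : 0 < Real.log q := Real.log_pos (by linarith)
  refine squeeze_zero (fun n => by positivity) (fun n => ?_)
    (tendsto_exp_neg_mul_nat (mul_pos (sub_pos.2 hR1) hl))
  rw [pow_eq_exp (show (0 : ℝ) < q by linarith) n]
  refine (div_le_div_of_nonneg_right (pow_floor_le hq hR0 n) (Real.exp_pos _).le).trans ?_
  rw [← Real.exp_sub]
  refine Real.exp_le_exp.2 (le_of_eq ?_)
  ring

variable {F : Type*} [Field F] [Fintype F] [DecidableEq F] {ω : ℝ}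

theorem exists_lower_bound_pgmSuccess (hR0 : 0 < R) (hR1 : R < 1) (h0 : 0 ≤ ω)
    (h1 : ω ≤ ((Fintype.card F : ℝ) - 1) / Fintype.card F)
    (h : R * Real.log (Fintype.card F) <
      Real.qaryEntropy (Fintype.card F) (perp (Fintype.card F) ω)) :
    ∃ g : ℕ → ℝ, Tendsto g atTop (𝓝 1) ∧
      ∀ᶠ n : ℕ in atTop, g n ≤ pgmSuccess F ⌊R * (n : ℝ)⌋₊ n ω := by
  have hτ0 := perp_nonneg (Fintype.card F) ω
  have hτ1 := le_one_of_mem two_le_card (perp_le two_le_card h0 h1)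
  set q := Fintype.card F with hq
  set τ := perp q ω
  obtain ⟨V, hV⟩ := exists_tail_bound (letterProb_nonneg (F := F) hτ0 hτ1) (sum_letterProb τ)
  rw [shannon_letterProb] at hV
  set H := Real.qaryEntropy q τ
  -- Half the entropy gap goes to the typicality window; the other half leaves the decay `q^k m ≤
  -- e^{-δn}`.
  set δ := (H - R * Real.log q) / 2 with hδ
  have hδ0 : 0 < δ := by linarith
  refine ⟨fun n => 1 - 3 * (V / δ ^ 2 / n) - Real.exp (-(δ * n)) -
    2 * ((q : ℝ) ^ ⌊R * (n : ℝ)⌋₊ / (q : ℝ) ^ n), ?_, ?_⟩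
  · have := (((tendsto_const_nhds (x := (1 : ℝ))).sub
      ((tendsto_const_div_atTop_nhds_zero_nat (V / δ ^ 2)).const_mul 3)).sub
      (tendsto_exp_neg_mul_nat hδ0)).sub
      ((tendsto_pow_floor_div_pow (q := q) two_le_card hR0.le hR1).const_mul 2)
    simpa using this
  · filter_upwards [eventually_gt_atTop 0] with n hn
    set m := Real.exp (-(n * (H - δ))) with hm
    have hm0 : 0 < m := Real.exp_pos _
    set T : Finset (Fin n → F) := Finset.univ.filter fun x => prodProb (letterProb τ) x ≤ m
    have hle := le_pgmSuccess (k := ⌊R * (n : ℝ)⌋₊) (T := T) h0 h1 hm0.le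
      fun x hx => (Finset.mem_filter.1 hx).2
    refine le_trans ?_ hle
    have htail : ∑ x ∈ Tᶜ, prodProb (letterProb τ) x ≤ V / δ ^ 2 / n := by
      refine hV n δ _ hn hδ0 fun x hx hx0 => ?_
      have hlt : m < prodProb (letterProb τ) x := by simpa [T] using hx
      have := (Real.lt_log_iff_exp_lt ((Real.exp_pos _).trans hlt)).2 hlt
      refine le_trans ?_ (le_abs_self _)
      linarith
    have hKm : (q : ℝ) ^ ⌊R * (n : ℝ)⌋₊ * m ≤ Real.exp (-(δ * n)) := by
      refine (mul_le_mul_of_nonneg_right (pow_floor_le (q := q) two_le_card hR0.le n)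
        hm0.le).trans ?_
      rw [hm, ← Real.exp_add]
      refine Real.exp_le_exp.2 (le_of_eq ?_)
      rw [hδ]
      ring
    linarith

/-- The bound `g` is chosen before the measurement, so it serves the PGM and every sequence of
algorithms alike. -/
theorem exists_upper_bound_success (hR0 : 0 < R) (hR1 : R < 1) (h0 : 0 ≤ ω)
    (h1 : ω ≤ ((Fintype.card F : ℝ) - 1) / Fintype.card F)
    (h : Real.qaryEntropy (Fintype.card F) (perp (Fintype.card F) ω) <
      R * Real.log (Fintype.card F)) :
    ∃ g : ℕ → ℝ, Tendsto g atTop (𝓝 0) ∧ ∀ᶠ n : ℕ in atTop,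
      ∀ M : (G : Matrix (Fin ⌊R * (n : ℝ)⌋₊) (Fin n) F) → codewords G →
        Matrix (Fin n → F) (Fin n → F) ℂ, (∀ G, IsSubPOVM (M G)) → success ω M ≤ g n := by
  have hτ0 := perp_nonneg (Fintype.card F) ω
  have hτ1 := le_one_of_mem two_le_card (perp_le two_le_card h0 h1)
  set q := Fintype.card F with hq
  have hq0 : (0 : ℝ) < q := card_pos_cast
  set τ := perp q ω
  obtain ⟨V, hV⟩ := exists_tail_bound (letterProb_nonneg (F := F) hτ0 hτ1) (sum_letterProb τ)
  rw [shannon_letterProb] at hV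
  set H := Real.qaryEntropy q τ
  set δ := (R * Real.log q - H) / 2 with hδ
  have hδ0 : 0 < δ := by linarith
  refine ⟨fun n => 2 * q * Real.exp (-(δ * n)) + 2 * (V / δ ^ 2 / n) +
    (q : ℝ) ^ ⌊R * (n : ℝ)⌋₊ / (q : ℝ) ^ n, ?_, ?_⟩
  · have := (((tendsto_exp_neg_mul_nat hδ0).const_mul (2 * (q : ℝ))).add
      ((tendsto_const_div_atTop_nhds_zero_nat (V / δ ^ 2)).const_mul 2)).add
      (tendsto_pow_floor_div_pow (q := q) two_le_card hR0.le hR1)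
    simpa using this
  · filter_upwards [eventually_gt_atTop 0] with n hn M hM
    set m := Real.exp (-(n * (H + δ))) with hm
    have hm0 : 0 < m := Real.exp_pos _
    set T : Finset (Fin n → F) := Finset.univ.filter fun x => m ≤ prodProb (letterProb τ) x
    refine (success_le h0 h1 hM T).trans ?_
    have htail : ∑ x ∈ Tᶜ, prodProb (letterProb τ) x ≤ V / δ ^ 2 / n := by
      refine hV n δ _ hn hδ0 fun x hx hx0 => ?_
      have hlt : prodProb (letterProb τ) x < m := by simpa [T] using hx
      have := (Real.log_lt_iff_lt_exp ((prodProb_nonneg (letterProb_nonneg hτ0 hτ1) x).lt_of_ne'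
        hx0)).2 hlt
      refine le_trans ?_ (neg_le_abs _)
      linarith
    -- Each word of `T` has probability at least `m`, so there are at most `1/m = e^{n(H+δ)}` of
    -- them.
    have hcard : T.card * m ≤ 1 := by
      rw [← sum_prodProb (sum_letterProb (F := F) τ) n, ← nsmul_eq_mul]
      refine (Finset.card_nsmul_le_sum T _ _ fun x hx => (Finset.mem_filter.1 hx).2).trans ?_
      exact Finset.sum_le_sum_of_subset_of_nonneg (Finset.subset_univ _) fun x _ _ =>
        prodProb_nonneg (letterProb_nonneg hτ0 hτ1) x
    have hT : 2 * T.card / (q : ℝ) ^ ⌊R * (n : ℝ)⌋₊ ≤ 2 * q * Real.exp (-(δ * n)) := by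
      rw [div_le_iff₀ (by positivity)]
      have h3 := exp_le_mul_pow_floor (R := R) (q := q) two_le_card n
      have h4 : Real.exp (R * n * Real.log q) * Real.exp (-(δ * n)) * m = 1 := by
        rw [hm, ← Real.exp_add, ← Real.exp_add, Real.exp_eq_one_iff, hδ]
        ring
      have h5 : (T.card : ℝ) ≤ Real.exp (R * n * Real.log q) * Real.exp (-(δ * n)) :=
        le_of_mul_le_mul_right (hcard.trans h4.ge) hm0
      have h6 := mul_le_mul_of_nonneg_right h3 (Real.exp_pos (-(δ * n))).le
      linarith
    linarith

end Asymptotics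

end QDP

end

/-! ### The threshold theorem -/

theorem mainTheorem2 {F : Type*} [Field F] [Fintype F] [DecidableEq F]
    (q : ℕ) (hq : Fintype.card F = q)
    (R : ℝ) (hR0 : 0 < R) (hR1 : R < 1)
    (ω : ℝ) (hω0 : 0 ≤ ω) (hω1 : ω ≤ ((q : ℝ) - 1) / q) :
    (ω < QDP.perp q (QDP.deltaMin q (1 - R)) →
      Tendsto (fun n : ℕ => QDP.pgmSuccess F ⌊R * (n : ℝ)⌋₊ n ω) atTop (𝓝 1) ∧
      ∃ A : (n : ℕ) → QDP.Algorithm F ⌊R * (n : ℝ)⌋₊ n,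
        Tendsto (fun n : ℕ => (A n).successProb ω) atTop (𝓝 1)) ∧
    (QDP.perp q (QDP.deltaMin q (1 - R)) < ω →
      Tendsto (fun n : ℕ => QDP.pgmSuccess F ⌊R * (n : ℝ)⌋₊ n ω) atTop (𝓝 0) ∧
      ∀ A : (n : ℕ) → QDP.Algorithm F ⌊R * (n : ℝ)⌋₊ n,
        Tendsto (fun n : ℕ => (A n).successProb ω) atTop (𝓝 0)) := by
  subst hq
  have hω : ω ≤ 1 := QDP.le_one_of_mem QDP.two_le_card hω1
  constructor
  · intro h
    obtain ⟨g, hg, hle⟩ := QDP.exists_lower_bound_pgmSuccess (F := F) hR0 hR1 hω0 hω1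
      (QDP.lt_qaryEntropy_perp QDP.two_le_card hR0.le hR1.le hω0 hω1 h)
    refine ⟨tendsto_of_tendsto_of_tendsto_of_le_of_le' hg tendsto_const_nhds hle
      (Eventually.of_forall fun n => QDP.success_le_one hω0 hω fun G => QDP.pgm_isSubPOVM _),
      fun n => QDP.completion _ fun G => QDP.pgm_isSubPOVM fun c : QDP.codewords G =>
        QDP.state ω c.1, ?_⟩
    refine tendsto_of_tendsto_of_tendsto_of_le_of_le' hg tendsto_const_nhds ?_
      (Eventually.of_forall fun n => QDP.success_le_one hω0 hω fun G => QDP.Algorithm.isSubPOVM _ G)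
    exact hle.mono fun n hn => hn.trans (QDP.success_le_completion _ _ _)
  · intro h
    obtain ⟨g, hg, hle⟩ := QDP.exists_upper_bound_success (F := F) hR0 hR1 hω0 hω1
      (QDP.qaryEntropy_perp_lt QDP.two_le_card hR0.le hR1.le hω0 hω1 h)
    refine ⟨?_, fun A => ?_⟩
    · exact squeeze_zero' (Eventually.of_forall fun n => QDP.success_nonneg ω fun G =>
        QDP.pgm_isSubPOVM _) (hle.mono fun n hn => hn _ fun G => QDP.pgm_isSubPOVM _) hg
    · exact squeeze_zero' (Eventually.of_forall fun n => QDP.success_nonneg ω fun G =>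
        (A n).isSubPOVM G) (hle.mono fun n hn => hn _ fun G => (A n).isSubPOVM G) hg
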